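/- Let $n\in\mathbb N$, let $O(n)$ be the orthogonal group of $\mathbb R^n$ with the operator norm metric, and let $\mathcal L^n$ be Lebesgue measure. For a space $X$ let $\mathcal M(X)$ be the set of non-zero Radon measures on $X$ with compact support. For a Radon measure $\mu$ on $\mathbb R^n$ and $s>0$ put $I_s(\mu)=\iint|x-y|^{-s}\,d\mu x\,d\mu y$ (the kernel is $\infty$ on the diagonal). Let $0<s,t<n$ and $u=s+t-n>0$. There is a constant $C=C(n,s,t)$ such that the following holds. Let $\beta>0$ with $u>n-\beta$, and let $\theta\in\mathcal M(O(n))$ be such that $\theta(O(n))\le 1$ and $$\theta(\{g\in O(n):|x-g(z)|<r\})\le (r/|z|)^{\beta}\quad\text{for all }x,z\in\mathbb R^n\setminus\{0\},\ r>0.$$ Let $\mu,\nu\in\mathcal M(\mathbb R^n)$ with $I_s(\mu)<\infty$ and $I_t(\nu)<\infty$. Let $\psi\ge 0$ be a $C^\infty$ function on $\mathbb R^n$ with support in the closed unit ball and integral $1$, and put $\psi_\varepsilon(x)=\varepsilon^{-n}\psi(x/\varepsilon)$, $\nu_\varepsilon=\psi_\varepsilon*\nu$ and $$\nu_{g,z,\varepsilon}(x)=\nu_\varepsilon(g^{-1}(x)-z),\qquad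 g\in O(n),\ x,z\in\mathbb R^n,\ \varepsilon>0 .$$ Then for $\theta\times\mathcal L^n$ almost all $(g,z)$ the measures $\nu_{g,g^{-1}(z),\varepsilon}\,\mu$ converge weakly, as $\varepsilon\to0$ (tested against continuous functions with compact support), to a Radon measure $\lambda_{g,z}$, and (a) $\operatorname{spt}\lambda_{g,z}\subset\operatorname{spt}\mu\cap(g(\operatorname{spt}\nu)+z)$ for $\theta\times\mathcal L^n$ almost all $(g,z)$; (b) for $\theta$ almost all $g$, $z\mapsto\lambda_{g,z}(\mathbb R^n)$ is $\mathcal L^n$ measurable and $\int\lambda_{g,z}(\mathbb R^n)\,d\mathcal L^n z=\mu(\mathbb R^n)\,\nu(\mathbb R^n)$; (c) $(g,z)\mapsto I_u(\lambda_{g,z})$ is $\theta\times\mathcal L^n$ measurable and $$\iint I_u(\lambda_{g,z})\,d\mathcal L^n z\,d\theta g\le C(n,s,t)\,\frac{\beta}{\beta+u-n}\,I_s(\mu)\,I_t(\nu).$$ -/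

import Mathlib

open MeasureTheory Set Filter Topology
open scoped ENNReal ContDiff

noncomputable section

/-- Euclidean `n`-space. -/
abbrev Euc (n : ℕ) : Type := EuclideanSpace ℝ (Fin n)

/-- The orthogonal group `O(n)`, as the group of operators `g` on Euclidean `n`-space with
`g* g = g g* = 1`, with the operator norm metric and its Borel σ-algebra. -/
abbrev OrthGroup (n : ℕ) : Type := unitary (Euc n →L[ℝ] Euc n)

/-- Non-zero Radon measures with compact support. It is used on `Euc n` and `OrthGroup n` only,
where every locally finite Borel measure is regular, so that Radon means locally finite. -/
structure IsRadonCompactSupport {X : Type*} [TopologicalSpace X] [MeasurableSpace X]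
    (μ : Measure X) : Prop where
  ne_zero : μ ≠ 0
  locallyFinite : IsLocallyFiniteMeasure μ
  isCompact_support : IsCompact μ.support

/-- The `s`-energy `∬ |x - y|^{-s} dμ x dμ y`. For `s > 0` the kernel is `∞` on the diagonal. -/
def energy {n : ℕ} (s : ℝ) (μ : Measure (Euc n)) : ℝ≥0∞ :=
  ∫⁻ x, ∫⁻ y, ‖x - y‖ₑ ^ (-s) ∂μ ∂μ

/-- Profiles of approximate identities: non-negative smooth functions with support in the
unit ball and with integral `1`. -/
structure IsProfile {n : ℕ} (ψ : Euc n → ℝ) : Prop where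
  nonneg : ∀ x, 0 ≤ ψ x
  smooth : ContDiff ℝ ∞ ψ
  tsupport_subset : tsupport ψ ⊆ Metric.closedBall 0 1
  integral_eq_one : ∫ x, ψ x = 1

/-- `ψ_ε(x) = ε^{-n} ψ(x / ε)`. -/
def approxId {n : ℕ} (ψ : Euc n → ℝ) (ε : ℝ) (x : Euc n) : ℝ :=
  (ε ^ n)⁻¹ * ψ (ε⁻¹ • x)

/-- `ν_ε = ψ_ε * ν`, that is `ν_ε(x) = ∫ ψ_ε(x - y) dν y`. -/
def mollify {n : ℕ} (ψ : Euc n → ℝ) (ν : Measure (Euc n)) (ε : ℝ) (x : Euc n) : ℝ :=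
  ∫ y, approxId ψ ε (x - y) ∂ν

/-- `ν_{g,z,ε}(x) = ν_ε(g⁻¹ x - z)`. -/
def movedDensity {n : ℕ} (ψ : Euc n → ℝ) (ν : Measure (Euc n)) (g : OrthGroup n) (z : Euc n)
    (ε : ℝ) (x : Euc n) : ℝ :=
  mollify ψ ν ε ((g⁻¹ : OrthGroup n).1 x - z)

/-- The measure `ν_{g,z,ε} μ`. -/
def movedMeasure {n : ℕ} (ψ : Euc n → ℝ) (ν μ : Measure (Euc n)) (g : OrthGroup n) (z : Euc n)
    (ε : ℝ) : Measure (Euc n) :=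
  μ.withDensity fun x => ENNReal.ofReal (movedDensity ψ ν g z ε x)

/-- Weak convergence of the measures `m ε` to `l` as `ε → 0`, `ε > 0`: convergence of the
integrals of all continuous functions with compact support. -/
def WeaklyConverges {n : ℕ} (m : ℝ → Measure (Euc n)) (l : Measure (Euc n)) : Prop :=
  ∀ φ : Euc n → ℝ, Continuous φ → HasCompactSupport φ →
    Tendsto (fun ε => ∫ x, φ x ∂(m ε)) (𝓝[>] 0) (𝓝 (∫ x, φ x ∂l))

/-- The decay condition of order `β` on a measure on `O(n)`. -/
structure HasDecay {n : ℕ} (θ : Measure (OrthGroup n)) (β : ℝ) : Prop where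
  mass_le_one : θ univ ≤ 1
  decay : ∀ x z : Euc n, x ≠ 0 → z ≠ 0 → ∀ r : ℝ, 0 < r →
    θ {g : OrthGroup n | ‖x - g.1 z‖ < r} ≤ ENNReal.ofReal ((r / ‖z‖) ^ β)

end

/-!
The measures `λ_{g,z}` are the slices of `μ × ν` along the fibres of `(x, y) ↦ x - g y`. Write
`ρ_g` for the push-forward of `μ × ν` under `(x, y) ↦ (x - g y, x)`. Whenever the first marginal
of `ρ_g` is absolutely continuous, `ρ_g = ∫ δ_z × λ_{g,z} dz` with `λ_{g,z}` jointly measurable in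
`(g, z)`: `exists_kernel_disintegration` combines a conditional kernel with a kernel Radon-Nikodym
derivative.

Everything quantitative happens on the Fourier side. The Riesz kernel is a superposition of
Gaussians, so the energy `I_s(m)` of a finite measure is a constant times
`∫ |ξ|^{s-n} |m̂(ξ)|² dξ` (`exists_energy_eq_lintegral_ft`). For fixed `ξ`, the function
`z ↦ λ̂_{g,z}(ξ)` is the density of the push-forward of `e^{-2πi⟪x, ξ⟫} d(μ × ν)` under
`(x, y) ↦ x - g y`. The Fourier transform of this complex measure has modulus
`|μ̂(ξ + η)| |ν̂(g⁻¹η)|` at `η`, so Plancherel's theorem (`exists_L2_density`) and the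
substitution `η = g y`, `ξ = x - g y` bound `∫ I_u(λ_{g,z}) dz` by a constant times
`∬ |x - g y|^{u-n} |μ̂(x)|² |ν̂(y)|² dx dy` (`lintegral_energy_slice_le`, `sliceEnergy_eq`). The
decay of `θ` and the layer cake formula give
`∫ |x - g y|^{u-n} dθ g ≲ β / (β + u - n) |x|^{s-n} |y|^{t-n}`
(`HasDecay.lintegral_rieszKernel_le_mul`), because `u - n = (s - n) + (t - n)`. This is the energy
estimate.

The same bound yields absolute continuity for almost all `g`. The push-forward of
`e^{-2πi⟪x, ξ⟫} d(μ × ν)` has a density in `L²` for almost every `ξ`, hence does not charge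
compact null sets, and letting `ξ` tend to `0` removes the exponential
(`absolutelyContinuous_of_sliceEnergy_lt_top`).

For a bounded test function `φ`, the integral of `φ` against the moved measure at scale `ε` is the
mollification at `z` of the integrable function `w ↦ ∫ φ dλ_{g,w}`, so it converges for almost
every `z` by Lebesgue differentiation. Countably many test functions, dense in `C(spt μ)`, suffice
for weak convergence, and the set of convergence is measurable in `(g, z)` because the limit may
be taken along rational `ε`.
-/

noncomputable section

/-! ### Riesz energies as Fourier integrals -/

theorem lintegral_Ioi_rpow_mul_exp {a r : ℝ} (ha : 0 < a) (hr : 0 < r) :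
    ∫⁻ τ in Ioi (0 : ℝ), ENNReal.ofReal (τ ^ (a - 1) * Real.exp (-(r * τ))) =
      ENNReal.ofReal ((1 / r) ^ a * Real.Gamma a) := by
  rw [← Real.integral_rpow_mul_exp_neg_mul_Ioi ha hr, ofReal_integral_eq_lintegral_ofReal]
  · have h := Real.integral_rpow_mul_exp_neg_mul_Ioi ha hr
    apply not_imp_comm.1 integral_undef
    rw [h]
    have := Real.Gamma_pos_of_pos ha
    positivity
  · filter_upwards [ae_restrict_mem measurableSet_Ioi] with τ hτ
    have : 0 < τ := hτ
    positivity

theorem lintegral_Ioi_rpow_eq_top (b : ℝ) :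
    ∫⁻ τ in Ioi (0 : ℝ), ENNReal.ofReal (τ ^ b) = ⊤ := by
  by_contra h
  apply not_integrableOn_Ioi_rpow b
  refine ⟨(by fun_prop : Measurable fun x : ℝ => x ^ b).aestronglyMeasurable, ?_⟩
  rw [hasFiniteIntegral_iff_ofReal]
  · exact lt_top_iff_ne_top.2 h
  · filter_upwards [ae_restrict_mem measurableSet_Ioi] with τ hτ
    exact Real.rpow_nonneg (le_of_lt hτ) _

/-- The Riesz kernel as a superposition of Gaussians. At `x = 0` both sides are infinite. -/
theorem lintegral_gaussian_eq_rieszKernel {n : ℕ} {s : ℝ} (hs : 0 < s) (x : Euc n) :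
    ∫⁻ τ in Ioi (0 : ℝ), ENNReal.ofReal (τ ^ (s / 2 - 1) * Real.exp (-(Real.pi * ‖x‖ ^ 2 * τ))) =
      ENNReal.ofReal ((1 / Real.pi) ^ (s / 2) * Real.Gamma (s / 2)) * ‖x‖ₑ ^ (-s) := by
  have hG := Real.Gamma_pos_of_pos (half_pos hs)
  rcases eq_or_ne x 0 with rfl | hx
  · have hc : ENNReal.ofReal ((1 / Real.pi) ^ (s / 2) * Real.Gamma (s / 2)) ≠ 0 := by
      rw [Ne, ENNReal.ofReal_eq_zero, not_le]
      have := Real.pi_pos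
      positivity
    rw [enorm_zero, ENNReal.zero_rpow_of_neg (neg_lt_zero.2 hs), ENNReal.mul_top hc]
    simp [lintegral_Ioi_rpow_eq_top]
  · have hx' : 0 < ‖x‖ := norm_pos_iff.2 hx
    rw [lintegral_Ioi_rpow_mul_exp (half_pos hs) (by have := Real.pi_pos; positivity),
      ← ofReal_norm, ENNReal.ofReal_rpow_of_pos hx', ← ENNReal.ofReal_mul (by positivity)]
    congr 1
    have : (1 / (Real.pi * ‖x‖ ^ 2)) ^ (s / 2) = (1 / Real.pi) ^ (s / 2) * ‖x‖ ^ (-s) := by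
      rw [one_div, mul_inv, Real.mul_rpow (by positivity) (by positivity), one_div,
        Real.rpow_neg hx'.le, Real.inv_rpow (by positivity) (s / 2), Real.inv_rpow (by positivity)]
      congr 2
      rw [← Real.rpow_natCast, ← Real.rpow_mul hx'.le]
      congr 1
      push_cast
      ring
    rw [this]
    ring

theorem lintegral_Ioi_comp_inv (f : ℝ → ℝ≥0∞) :
    ∫⁻ τ in Ioi (0 : ℝ), f τ = ∫⁻ τ in Ioi (0 : ℝ), ENNReal.ofReal (τ ^ (-2 : ℝ)) * f τ⁻¹ := by
  have himg : (fun τ : ℝ => τ⁻¹) '' Ioi 0 = Ioi 0 := by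
    ext x
    simp only [Set.mem_image, mem_Ioi]
    exact ⟨fun ⟨y, hy, h⟩ => h ▸ inv_pos.2 hy, fun h => ⟨x⁻¹, inv_pos.2 h, inv_inv x⟩⟩
  conv_lhs => rw [← himg]
  rw [lintegral_image_eq_lintegral_abs_deriv_mul measurableSet_Ioi
    (fun x hx => (hasDerivAt_inv (ne_of_gt hx)).hasDerivWithinAt) (inv_injective.injOn)]
  refine setLIntegral_congr_fun measurableSet_Ioi fun τ hτ => ?_
  have hτ' : (0 : ℝ) < τ := hτ
  congr 2
  rw [Real.rpow_neg hτ'.le, abs_neg, abs_of_pos (by positivity)]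
  norm_num

/-- The Fourier transforms of the Gaussians in `lintegral_gaussian_eq_rieszKernel`, superposed with
the same weights, give the Riesz kernel of the complementary order. -/
theorem lintegral_gaussian_inv_eq_rieszKernel {n : ℕ} {s : ℝ} (hsn : s < n) (x : Euc n) :
    ∫⁻ τ in Ioi (0 : ℝ), ENNReal.ofReal (τ ^ (s / 2 - 1)) *
        ENNReal.ofReal (τ ^ (-(n : ℝ) / 2) * Real.exp (-(Real.pi * ‖x‖ ^ 2 / τ))) =
      ENNReal.ofReal ((1 / Real.pi) ^ ((n - s) / 2) * Real.Gamma ((n - s) / 2)) *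
        ‖x‖ₑ ^ (s - n) := by
  have := lintegral_gaussian_eq_rieszKernel (sub_pos.2 hsn) x
  rw [neg_sub] at this
  rw [← this, lintegral_Ioi_comp_inv]
  refine setLIntegral_congr_fun measurableSet_Ioi fun τ hτ => ?_
  have hτ' : (0 : ℝ) < τ := hτ
  rw [← ENNReal.ofReal_mul (by positivity), ← ENNReal.ofReal_mul (by positivity)]
  congr 1
  rw [Real.inv_rpow hτ'.le, Real.inv_rpow hτ'.le, ← Real.rpow_neg hτ'.le, ← Real.rpow_neg hτ'.le,
    div_inv_eq_mul, ← mul_assoc, ← mul_assoc, ← Real.rpow_add hτ', ← Real.rpow_add hτ']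
  congr 2
  ring

/-- The character `x ↦ exp (-2πi⟪x, ξ⟫)`. -/
def chr {n : ℕ} (x ξ : Euc n) : ℂ := (Real.fourierChar (-(inner ℝ x ξ)) : Circle)

@[fun_prop]
theorem continuous_chr {n : ℕ} : Continuous fun p : Euc n × Euc n => chr p.1 p.2 := by
  unfold chr
  fun_prop

@[fun_prop]
theorem measurable_chr {n : ℕ} : Measurable fun p : Euc n × Euc n => chr p.1 p.2 :=
  continuous_chr.measurable

@[simp]
theorem norm_chr {n : ℕ} (x ξ : Euc n) : ‖chr x ξ‖ = 1 := Circle.norm_coe _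

@[simp]
theorem chr_zero_right {n : ℕ} (x : Euc n) : chr x 0 = 1 := by simp [chr]

theorem chr_comm {n : ℕ} (x ξ : Euc n) : chr x ξ = chr ξ x := by
  rw [chr, chr, real_inner_comm]

theorem chr_add_left {n : ℕ} (x y ξ : Euc n) : chr (x + y) ξ = chr x ξ * chr y ξ := by
  simp [chr, inner_add_left, AddChar.map_add_eq_mul, mul_comm]

theorem chr_add_right {n : ℕ} (x ξ η : Euc n) : chr x (ξ + η) = chr x ξ * chr x η := by
  rw [chr_comm, chr_add_left, chr_comm ξ, chr_comm η]

theorem chr_neg_left {n : ℕ} (x ξ : Euc n) : chr (-x) ξ = (starRingEnd ℂ) (chr x ξ) := by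
  rw [chr, chr, inner_neg_left, AddChar.map_neg_eq_inv, Circle.coe_inv_eq_conj]

theorem chr_sub_left {n : ℕ} (x y ξ : Euc n) :
    chr (x - y) ξ = chr x ξ * (starRingEnd ℂ) (chr y ξ) := by
  rw [sub_eq_add_neg, chr_add_left, chr_neg_left]

theorem integrable_chr {n : ℕ} {X : Type*} [MeasurableSpace X] {m : Measure X} [IsFiniteMeasure m]
    {f g : X → Euc n} (hf : Measurable f) (hg : Measurable g) :
    Integrable (fun x => chr (f x) (g x)) m :=
  Integrable.of_bound (measurable_chr.comp (hf.prodMk hg)).aestronglyMeasurable 1 (by simp)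

/-- The Fourier transform `m̂(ξ) = ∫ exp (-2πi⟪x, ξ⟫) dm x` of a measure. -/
def ft {n : ℕ} (m : Measure (Euc n)) (ξ : Euc n) : ℂ := ∫ x, chr x ξ ∂m

theorem continuous_ft {n : ℕ} (m : Measure (Euc n)) [IsFiniteMeasure m] : Continuous (ft m) := by
  refine continuous_of_dominated (bound := fun _ => 1) ?_ ?_ (integrable_const _) ?_
  · intro ξ
    exact (Continuous.aestronglyMeasurable (by fun_prop))
  · simp
  · exact .of_forall fun x => by fun_prop

theorem norm_ft_le {n : ℕ} (m : Measure (Euc n)) [IsFiniteMeasure m] (ξ : Euc n) :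
    ‖ft m ξ‖ ≤ m.real univ := by
  refine (norm_integral_le_of_norm_le_const (C := 1) (by simp)).trans (by simp)

theorem integral_chr_sub_prod {n : ℕ} (m : Measure (Euc n)) [IsFiniteMeasure m] (ξ : Euc n) :
    ∫ p, chr (p.1 - p.2) ξ ∂(m.prod m) = ((‖ft m ξ‖ ^ 2 : ℝ) : ℂ) := by
  simp_rw [chr_sub_left]
  rw [integral_prod_mul (fun x => chr x ξ) (fun y => (starRingEnd ℂ) (chr y ξ)), integral_conj]
  rw [← ft, Complex.mul_conj, Complex.normSq_eq_norm_sq]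

theorem integrable_gaussian {n : ℕ} {τ : ℝ} (hτ : 0 < τ) :
    Integrable fun ξ : Euc n => τ ^ (-(n : ℝ) / 2) * Real.exp (-(Real.pi * ‖ξ‖ ^ 2 / τ)) := by
  have h := GaussianFourier.integrable_cexp_neg_mul_sq_norm_add (V := Euc n)
    (b := (Real.pi / τ : ℝ)) (by have := Real.pi_pos; rw [Complex.ofReal_re]; positivity) 0 0
  refine (h.norm.congr (.of_forall fun ξ => ?_)).const_mul _
  simp only [Complex.norm_exp]
  congr 1
  simp [← Complex.ofReal_pow]
  ring

/-- The Fourier transform of a Gaussian. -/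
theorem integral_gaussian_mul_chr {n : ℕ} {τ : ℝ} (hτ : 0 < τ) (x : Euc n) :
    ∫ ξ : Euc n, chr x ξ *
      ((τ ^ (-(n : ℝ) / 2) * Real.exp (-(Real.pi * ‖ξ‖ ^ 2 / τ)) : ℝ) : ℂ) =
      ((Real.exp (-(Real.pi * τ * ‖x‖ ^ 2)) : ℝ) : ℂ) := by
  have hpi := Real.pi_pos
  have h := fourier_gaussian_innerProductSpace (V := Euc n) (b := (Real.pi / τ : ℝ))
    (by rw [Complex.ofReal_re]; positivity) x
  rw [Real.fourier_eq] at h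
  have e1 : ((Real.pi : ℂ) / ((Real.pi / τ : ℝ) : ℂ)) ^ ((Module.finrank ℝ (Euc n) : ℂ) / 2) =
      ((τ ^ ((n : ℝ) / 2) : ℝ) : ℂ) := by
    rw [Complex.ofReal_cpow hτ.le, finrank_euclideanSpace_fin]
    push_cast
    congr 1
    have := hτ.ne'
    field_simp
  rw [e1] at h
  have e2 : ∀ ξ : Euc n, chr x ξ *
      ((τ ^ (-(n : ℝ) / 2) * Real.exp (-(Real.pi * ‖ξ‖ ^ 2 / τ)) : ℝ) : ℂ) =
      ((τ ^ (-(n : ℝ) / 2) : ℝ) : ℂ) * (Real.fourierChar (-(inner ℝ ξ x)) •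
        Complex.exp (-((Real.pi / τ : ℝ) : ℂ) * ‖ξ‖ ^ 2)) := by
    intro ξ
    rw [chr_comm, chr, Circle.smul_def, smul_eq_mul]
    push_cast
    rw [show -((Real.pi : ℂ) / τ) * (‖ξ‖ : ℂ) ^ 2 = -(Real.pi * ‖ξ‖ ^ 2 / τ) by ring]
    ring
  simp_rw [e2]
  rw [integral_const_mul, h, ← mul_assoc, ← Complex.ofReal_mul, ← Real.rpow_add hτ]
  rw [show -(n : ℝ) / 2 + n / 2 = 0 by ring, Real.rpow_zero]
  push_cast
  rw [one_mul]
  congr 1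
  have := hτ.ne'
  field_simp

/-- The Gaussian energy of a finite measure on the Fourier side: expand `|m̂(ξ)|²` as a double
integral of characters and integrate in `ξ` first. -/
theorem lintegral_gaussian_energy {n : ℕ} {τ : ℝ} (hτ : 0 < τ) (m : Measure (Euc n))
    [IsFiniteMeasure m] :
    ∫⁻ p, ENNReal.ofReal (Real.exp (-(Real.pi * τ * ‖p.1 - p.2‖ ^ 2))) ∂(m.prod m) =
      ∫⁻ ξ : Euc n, ENNReal.ofReal (τ ^ (-(n : ℝ) / 2) * Real.exp (-(Real.pi * ‖ξ‖ ^ 2 / τ))) *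
        ‖ft m ξ‖ₑ ^ 2 := by
  have hpi := Real.pi_pos
  have hint := integrable_gaussian (n := n) hτ
  have key : ∫ p, Real.exp (-(Real.pi * τ * ‖p.1 - p.2‖ ^ 2)) ∂(m.prod m) =
      ∫ ξ : Euc n, (τ ^ (-(n : ℝ) / 2) * Real.exp (-(Real.pi * ‖ξ‖ ^ 2 / τ))) * ‖ft m ξ‖ ^ 2 := by
    apply Complex.ofReal_injective
    rw [← integral_complex_ofReal, ← integral_complex_ofReal]
    simp_rw [← integral_gaussian_mul_chr hτ]
    rw [integral_integral_swap]
    · refine integral_congr_ae (.of_forall fun ξ => ?_)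
      dsimp only
      rw [integral_mul_const, integral_chr_sub_prod]
      push_cast
      ring
    · have h1 : Integrable (fun q : (Euc n × Euc n) × Euc n => (1 : ℝ) *
          (τ ^ (-(n : ℝ) / 2) * Real.exp (-(Real.pi * ‖q.2‖ ^ 2 / τ))))
          ((m.prod m).prod volume) := (integrable_const (1 : ℝ)).mul_prod hint
      refine h1.mono' (Measurable.aestronglyMeasurable ?_) (.of_forall fun q => ?_)
      · simp only [Function.uncurry_def]
        fun_prop
      · simp only [Function.uncurry_def]
        rw [norm_mul, norm_chr, Complex.norm_real, Real.norm_of_nonneg (by positivity)]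
  have hl : Integrable (fun p : Euc n × Euc n => Real.exp (-(Real.pi * τ * ‖p.1 - p.2‖ ^ 2)))
      (m.prod m) := by
    refine Integrable.of_bound (by fun_prop) 1 (.of_forall fun p => ?_)
    rw [Real.norm_of_nonneg (by positivity), Real.exp_le_one_iff, neg_nonpos]
    positivity
  have hr : Integrable (fun ξ : Euc n =>
      (τ ^ (-(n : ℝ) / 2) * Real.exp (-(Real.pi * ‖ξ‖ ^ 2 / τ))) * ‖ft m ξ‖ ^ 2) := by
    refine hint.mul_bdd (c := m.real univ ^ 2) ?_ (.of_forall fun ξ => ?_)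
    · exact ((continuous_ft m).norm.pow 2).aestronglyMeasurable
    · rw [norm_pow, norm_norm]
      exact pow_le_pow_left₀ (norm_nonneg _) (norm_ft_le m ξ) 2
  rw [← ofReal_integral_eq_lintegral_ofReal hl (.of_forall fun p => by positivity), key,
    ofReal_integral_eq_lintegral_ofReal hr (.of_forall fun p => by positivity)]
  refine lintegral_congr fun ξ => ?_
  rw [ENNReal.ofReal_mul (by positivity), ENNReal.ofReal_pow (norm_nonneg _), ofReal_norm]

/-- The Fourier representation of the energy of a finite measure, up to a constant. -/
theorem exists_energy_eq_lintegral_ft {n : ℕ} {s : ℝ} (hs : 0 < s) (hsn : s < n) :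
    ∃ c : ℝ, 0 < c ∧ ∀ m : Measure (Euc n), IsFiniteMeasure m →
      energy s m = ENNReal.ofReal c * ∫⁻ ξ : Euc n, ‖ξ‖ₑ ^ (s - n) * ‖ft m ξ‖ₑ ^ 2 := by
  set a := (1 / Real.pi) ^ (s / 2) * Real.Gamma (s / 2) with ha
  set b := (1 / Real.pi) ^ ((n - s) / 2) * Real.Gamma ((n - s) / 2) with hb
  have hpi := Real.pi_pos
  have ha0 : 0 < a := by
    have := Real.Gamma_pos_of_pos (half_pos hs)
    positivity
  have hb0 : 0 < b := by
    have := Real.Gamma_pos_of_pos (half_pos (sub_pos.2 hsn))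
    positivity
  refine ⟨a⁻¹ * b, by positivity, fun m hm => ?_⟩
  have hft : Measurable (ft m) := (continuous_ft m).measurable
  -- Tonelli's theorem for the weights, on the physical side and on the Fourier side
  have key : ENNReal.ofReal a * energy s m =
      ENNReal.ofReal b * ∫⁻ ξ : Euc n, ‖ξ‖ₑ ^ (s - n) * ‖ft m ξ‖ₑ ^ 2 := by
    calc ENNReal.ofReal a * energy s m
        = ∫⁻ p, ENNReal.ofReal a * ‖p.1 - p.2‖ₑ ^ (-s) ∂(m.prod m) := by
          rw [lintegral_const_mul _ (by fun_prop), energy, lintegral_prod _ (by fun_prop)]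
      _ = ∫⁻ p, (∫⁻ τ in Ioi (0 : ℝ), ENNReal.ofReal (τ ^ (s / 2 - 1)) *
            ENNReal.ofReal (Real.exp (-(Real.pi * τ * ‖p.1 - p.2‖ ^ 2)))) ∂(m.prod m) := by
          refine lintegral_congr fun p => ?_
          rw [ha, ← lintegral_gaussian_eq_rieszKernel hs]
          refine setLIntegral_congr_fun measurableSet_Ioi fun τ hτ => ?_
          have hτ' : (0 : ℝ) < τ := hτ
          rw [← ENNReal.ofReal_mul (by positivity)]
          ring_nf
      _ = ∫⁻ τ in Ioi (0 : ℝ), ∫⁻ ξ : Euc n, ENNReal.ofReal (τ ^ (s / 2 - 1)) *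
            ENNReal.ofReal (τ ^ (-(n : ℝ) / 2) * Real.exp (-(Real.pi * ‖ξ‖ ^ 2 / τ))) *
            ‖ft m ξ‖ₑ ^ 2 := by
          rw [lintegral_lintegral_swap (by fun_prop)]
          refine setLIntegral_congr_fun measurableSet_Ioi fun τ hτ => ?_
          have hτ' : (0 : ℝ) < τ := hτ
          rw [lintegral_const_mul _ (by fun_prop), lintegral_gaussian_energy hτ',
            ← lintegral_const_mul _ (by fun_prop)]
          simp_rw [mul_assoc]
      _ = ∫⁻ ξ : Euc n, ENNReal.ofReal b * (‖ξ‖ₑ ^ (s - n) * ‖ft m ξ‖ₑ ^ 2) := by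
          rw [lintegral_lintegral_swap (by fun_prop)]
          refine lintegral_congr fun ξ => ?_
          rw [lintegral_mul_const _ (by fun_prop), lintegral_gaussian_inv_eq_rieszKernel hsn,
            mul_assoc]
      _ = _ := lintegral_const_mul _ (by fun_prop)
  have h1 : ENNReal.ofReal a ≠ 0 := by simpa using ha0
  rw [ENNReal.ofReal_mul (by positivity), mul_assoc, ← key, ENNReal.ofReal_inv_of_pos ha0,
    ← mul_assoc, ENNReal.inv_mul_cancel h1 ENNReal.ofReal_ne_top, one_mul]

/-! ### Complex measures with square integrable Fourier transform -/

open scoped FourierTransform SchwartzMap in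
/-- A complex measure, given as the push-forward under `T` of `h m`, whose Fourier transform `H` is
square integrable has, in the sense of distributions, a density `G` in `L²` with the same norm
as `H`. -/
theorem exists_L2_density {n : ℕ} {X : Type*} [MeasurableSpace X] (m : Measure X)
    [IsFiniteMeasure m] {h : X → ℂ} (hh : Measurable h) (hh1 : ∀ x, ‖h x‖ ≤ 1) {T : X → Euc n}
    (hT : Measurable T)
    (hH : ∫⁻ η, ‖∫ x, h x * chr (T x) η ∂m‖ₑ ^ 2 < ⊤) :
    ∃ G : Euc n → ℂ, MemLp G 2 volume ∧
      ∫⁻ z, ‖G z‖ₑ ^ 2 = ∫⁻ η, ‖∫ x, h x * chr (T x) η ∂m‖ₑ ^ 2 ∧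
      ∀ φ : 𝓢(Euc n, ℂ), ∫ x, φ (T x) * h x ∂m = ∫ z, φ z * G z := by
  set H : Euc n → ℂ := fun η => ∫ x, h x * chr (T x) η ∂m with hHdef
  have hHm : StronglyMeasurable H := by
    have : Measurable fun p : Euc n × X => h p.2 * chr (T p.2) p.1 := by fun_prop
    exact this.stronglyMeasurable.integral_prod_right'
  have hsq : ∀ f : Euc n → ℂ, eLpNorm f 2 volume ^ 2 = ∫⁻ z, ‖f z‖ₑ ^ 2 := by
    intro f
    have := eLpNorm_nnreal_pow_eq_lintegral (p := 2) (f := f) (μ := (volume : Measure (Euc n)))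
      two_ne_zero
    simpa using this
  have hHL : MemLp H 2 volume := by
    refine ⟨hHm.aestronglyMeasurable, ?_⟩
    change ∫⁻ η, ‖H η‖ₑ ^ 2 < ⊤ at hH
    rw [← hsq] at hH
    by_contra hcon
    rw [not_lt_top_iff] at hcon
    simp [hcon] at hH
  set Hp : Lp ℂ 2 (volume : Measure (Euc n)) := hHL.toLp H with hHp
  refine ⟨(𝓕⁻ Hp : Lp ℂ 2 (volume : Measure (Euc n))), Lp.memLp _, ?_, fun φ => ?_⟩
  · have h1 : ‖(𝓕⁻ Hp : Lp ℂ 2 (volume : Measure (Euc n)))‖ = ‖Hp‖ :=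
      (Lp.fourierTransformₗᵢ (Euc n) ℂ).symm.norm_map Hp
    have h2 : ‖(𝓕⁻ Hp : Lp ℂ 2 (volume : Measure (Euc n)))‖ₑ = ‖Hp‖ₑ := by
      rw [← ofReal_norm, h1, ofReal_norm]
    rw [Lp.enorm_def, Lp.enorm_def, eLpNorm_congr_ae hHL.coeFn_toLp] at h2
    rw [← hsq, ← hsq, h2]
  · -- the inverse transform in `L²` is the inverse transform of tempered distributions
    have h1 := congrArg (fun u => u φ) (Lp.fourierInv_toTemperedDistribution_eq Hp)
    simp only [TemperedDistribution.fourierInv_apply, Lp.toTemperedDistribution_apply,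
      smul_eq_mul] at h1
    rw [← h1]
    have h2 : ∫ x, (𝓕⁻ φ) x * Hp x = ∫ η, ∫ x, (𝓕⁻ φ) η * (h x * chr (T x) η) ∂m := by
      refine integral_congr_ae ?_
      filter_upwards [hHL.coeFn_toLp] with η hη
      rw [hHp, hη, hHdef, integral_const_mul]
    rw [h2, integral_integral_swap]
    · refine integral_congr_ae (.of_forall fun x => ?_)
      dsimp only
      have h3 : (𝓕 (𝓕⁻ φ)) (T x) = φ (T x) := by rw [FourierTransform.fourier_fourierInv_eq]
      rw [← h3, SchwartzMap.fourier_coe, Real.fourier_eq, ← integral_mul_const]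
      refine integral_congr_ae (.of_forall fun η => ?_)
      dsimp only
      rw [chr_comm, chr, Circle.smul_def, smul_eq_mul]
      ring
    · have hi : Integrable (fun q : Euc n × X => ‖(𝓕⁻ φ) q.1‖ * (1 : ℝ)) (volume.prod m) :=
        (𝓕⁻ φ).integrable.norm.mul_prod (integrable_const (1 : ℝ))
      refine hi.mono' (Measurable.aestronglyMeasurable ?_) (.of_forall fun q => ?_)
      · simp only [Function.uncurry_def]
        have : Measurable fun p : Euc n × X => h p.2 * chr (T p.2) p.1 := by fun_prop
        exact ((𝓕⁻ φ).continuous.measurable.comp measurable_fst).mul this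
      · simp only [Function.uncurry_def]
        rw [norm_mul, norm_mul, norm_chr, mul_one]
        gcongr
        exact hh1 _

/-- A smooth function with values in `[0, 1]` which is `1` exactly on a given compact set and has
compact support. -/
theorem exists_contDiff_eq_one_iff {n : ℕ} {K : Set (Euc n)} (hK : IsCompact K) :
    ∃ f : Euc n → ℝ, ContDiff ℝ ∞ f ∧ HasCompactSupport f ∧ (∀ x, 0 ≤ f x) ∧ (∀ x, f x ≤ 1) ∧
      ∀ x, f x = 1 ↔ x ∈ K := by
  obtain ⟨R, hR⟩ := hK.isBounded.subset_ball (0 : Euc n)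
  obtain ⟨f, hf, hr, h0, h1⟩ := exists_contMDiff_zero_iff_one_iff_of_isClosed
    (n := (⊤ : ℕ∞)) (modelWithCornersSelf ℝ (Euc n))
    (Metric.isOpen_ball (x := (0 : Euc n)) (ε := R)).isClosed_compl
    hK.isClosed (disjoint_compl_left_iff_subset.2 hR)
  refine ⟨f, hf.contDiff, ?_, fun x => (hr ⟨x, rfl⟩).1, fun x => (hr ⟨x, rfl⟩).2,
    fun x => (h1 x).symm⟩
  refine HasCompactSupport.intro (isCompact_closedBall (0 : Euc n) R) fun x hx => ?_
  exact (h0 x).1 fun hx' => hx (Metric.ball_subset_closedBall hx')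

open scoped SchwartzMap in
/-- A complex measure which has a density in the sense of distributions does not charge compact
null sets. -/
theorem integral_indicator_eq_zero_of_density {n : ℕ} {X : Type*} [MeasurableSpace X]
    (m : Measure X) [IsFiniteMeasure m] {h : X → ℂ} (hh : Measurable h) (hh1 : ∀ x, ‖h x‖ ≤ 1)
    {T : X → Euc n} (hT : Measurable T) {G : Euc n → ℂ} (hG : MemLp G 2 volume)
    (hGφ : ∀ φ : 𝓢(Euc n, ℂ), ∫ x, φ (T x) * h x ∂m = ∫ z, φ z * G z)
    {K : Set (Euc n)} (hK : IsCompact K) (hK0 : volume K = 0) :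
    ∫ x in T ⁻¹' K, h x ∂m = 0 := by
  obtain ⟨f, hf, hfc, hf0, hf1, hfK⟩ := exists_contDiff_eq_one_iff hK
  have hlim : ∀ z, Tendsto (fun k : ℕ => ((f z ^ (k + 1) : ℝ) : ℂ)) atTop
      (𝓝 (K.indicator (fun _ => 1) z)) := by
    intro z
    by_cases hz : z ∈ K
    · simp [hz, (hfK z).2 hz]
    · rw [indicator_of_notMem hz, ← Complex.ofReal_zero]
      refine (Complex.continuous_ofReal.tendsto 0).comp ?_
      exact (tendsto_pow_atTop_nhds_zero_of_lt_one (hf0 z)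
        (lt_of_le_of_ne (hf1 z) fun h => hz ((hfK z).1 h))).comp (tendsto_add_atTop_nat 1)
  have hb : ∀ z (k : ℕ), ‖((f z ^ (k + 1) : ℝ) : ℂ)‖ ≤ f z := by
    intro z k
    rw [Complex.norm_real, Real.norm_of_nonneg (pow_nonneg (hf0 z) _)]
    exact pow_le_of_le_one (hf0 z) (hf1 z) (Nat.succ_ne_zero k)
  have hfG : Integrable (fun z => f z * ‖G z‖) := by
    have hl : LocallyIntegrable G := hG.locallyIntegrable (by norm_num)
    have := (hl.integrable_smul_left_of_hasCompactSupport hf.continuous hfc).norm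
    refine this.congr (.of_forall fun z => ?_)
    simp [abs_of_nonneg (hf0 z)]
  -- the powers of `f` decrease to the indicator function of `K`
  have L1 : Tendsto (fun k : ℕ => ∫ x, ((f (T x) ^ (k + 1) : ℝ) : ℂ) * h x ∂m) atTop
      (𝓝 (∫ x, K.indicator (fun _ => 1) (T x) * h x ∂m)) := by
    refine tendsto_integral_of_dominated_convergence (fun _ => 1) (fun k => ?_)
      (integrable_const _) (fun k => .of_forall fun x => ?_) (.of_forall fun x => ?_)
    · have := hf.continuous.measurable.comp hT
      exact (((Complex.measurable_ofReal.comp (this.pow_const _))).mul hh).aestronglyMeasurable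
    · rw [norm_mul]
      exact mul_le_one₀ ((hb _ _).trans (hf1 _)) (norm_nonneg _) (hh1 x)
    · exact (hlim (T x)).mul_const _
  have L2 : Tendsto (fun k : ℕ => ∫ z, ((f z ^ (k + 1) : ℝ) : ℂ) * G z) atTop
      (𝓝 (∫ z, K.indicator (fun _ => 1) z * G z)) := by
    refine tendsto_integral_of_dominated_convergence (fun z => f z * ‖G z‖) (fun k => ?_)
      hfG (fun k => .of_forall fun z => ?_) (.of_forall fun z => ?_)
    · exact (Complex.measurable_ofReal.comp (hf.continuous.measurable.pow_const _)
        ).aestronglyMeasurable.mul hG.1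
    · rw [norm_mul]
      gcongr
      exact hb _ _
    · exact (hlim z).mul_const _
  have heq : ∀ k : ℕ, ∫ x, ((f (T x) ^ (k + 1) : ℝ) : ℂ) * h x ∂m =
      ∫ z, ((f z ^ (k + 1) : ℝ) : ℂ) * G z := by
    intro k
    have hc : HasCompactSupport fun z => ((f z ^ (k + 1) : ℝ) : ℂ) := by
      refine hfc.comp_left (g := fun t : ℝ => ((t ^ (k + 1) : ℝ) : ℂ)) ?_
      simp
    have hs : ContDiff ℝ ∞ fun z => ((f z ^ (k + 1) : ℝ) : ℂ) :=
      Complex.ofRealCLM.contDiff.comp (hf.pow _)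
    exact hGφ (hc.toSchwartzMap hs)
  simp_rw [heq] at L1
  have := tendsto_nhds_unique L1 L2
  have e1 : ∫ x, K.indicator (fun _ => 1) (T x) * h x ∂m = ∫ x in T ⁻¹' K, h x ∂m := by
    rw [← integral_indicator (hT hK.measurableSet)]
    refine integral_congr_ae (.of_forall fun x => ?_)
    by_cases hx : T x ∈ K <;> simp [indicator, hx]
  have e2 : ∫ z, K.indicator (fun _ => 1) z * G z = 0 := by
    refine integral_eq_zero_of_ae ?_
    have : ∀ᵐ z ∂(volume : Measure (Euc n)), z ∉ K := measure_eq_zero_iff_ae_notMem.1 hK0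
    filter_upwards [this] with z hz
    simp [hz]
  rw [← e1, this, e2]

open scoped SchwartzMap in
/-- An integrable function and a square integrable function that define the same distribution have
the same `L²` norm, which may be infinite a priori. -/
theorem lintegral_sq_eq_of_density {n : ℕ} {F G : Euc n → ℂ} (hF : Integrable F)
    (hG : MemLp G 2 volume)
    (h : ∀ φ : 𝓢(Euc n, ℂ), ∫ z, φ z * F z = ∫ z, φ z * G z) :
    ∫⁻ z, ‖F z‖ₑ ^ 2 = ∫⁻ z, ‖G z‖ₑ ^ 2 := by
  have : ∀ᵐ z ∂(volume : Measure (Euc n)), F z = G z := by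
    refine ae_eq_of_integral_contDiff_smul_eq hF.locallyIntegrable
      (hG.locallyIntegrable (by norm_num)) fun g hg hgc => ?_
    have hc : HasCompactSupport fun z => ((g z : ℝ) : ℂ) :=
      hgc.comp_left (g := fun t : ℝ => (t : ℂ)) (by simp)
    have hs : ContDiff ℝ ∞ fun z => ((g z : ℝ) : ℂ) := Complex.ofRealCLM.contDiff.comp hg
    simpa using h (hc.toSchwartzMap hs)
  refine lintegral_congr_ae ?_
  filter_upwards [this] with z hz
  rw [hz]

/-! ### Averages of the Riesz kernel over the orthogonal group -/

theorem lintegral_Ioi_rpow {γ a : ℝ} (hγ : 0 < γ) (ha : 0 < a) :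
    ∫⁻ ρ in Ioi a, ENNReal.ofReal (γ * ρ ^ (-γ - 1)) = ENNReal.ofReal (a ^ (-γ)) := by
  rw [← ofReal_integral_eq_lintegral_ofReal]
  · rw [integral_const_mul, integral_Ioi_rpow_of_lt (by linarith) ha]
    congr 1
    rw [sub_add_cancel]
    field_simp
  · exact (integrableOn_Ioi_rpow_of_lt (by linarith) ha).const_mul γ
  · filter_upwards [ae_restrict_mem measurableSet_Ioi] with ρ hρ
    have : 0 < ρ := ha.trans hρ
    positivity

theorem lintegral_Ioc_rpow {γ β a : ℝ} (hγ : 0 < γ) (hβ : γ < β) (ha : 0 < a) :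
    ∫⁻ ρ in Ioc 0 a, ENNReal.ofReal (γ * ρ ^ (-γ - 1)) * ENNReal.ofReal ((ρ / a) ^ β) =
      ENNReal.ofReal (γ / (β - γ) * a ^ (-γ)) := by
  have e : ∀ ρ ∈ Ioc 0 a, ENNReal.ofReal (γ * ρ ^ (-γ - 1)) * ENNReal.ofReal ((ρ / a) ^ β) =
      ENNReal.ofReal (γ * a ^ (-β) * ρ ^ (β - γ - 1)) := by
    intro ρ hρ
    have hρ0 := hρ.1
    rw [← ENNReal.ofReal_mul (by positivity), Real.div_rpow hρ0.le ha.le, Real.rpow_neg ha.le,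
      show β - γ - 1 = (-γ - 1) + β by ring, Real.rpow_add hρ0]
    congr 1
    ring
  rw [setLIntegral_congr_fun measurableSet_Ioc e, ← ofReal_integral_eq_lintegral_ofReal]
  · rw [integral_const_mul, ← intervalIntegral.integral_of_le ha.le,
      integral_rpow (Or.inl (by linarith)), sub_add_cancel, Real.zero_rpow (by linarith), sub_zero,
      sub_eq_neg_add β γ, add_comm (-γ) β, Real.rpow_add ha]
    congr 1
    have h1 : a ^ (-β) * a ^ β = 1 := by rw [← Real.rpow_add ha]; simp
    calc γ * a ^ (-β) * (a ^ β * a ^ (-γ) / (β + -γ))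
        = (a ^ (-β) * a ^ β) * (γ / (β + -γ) * a ^ (-γ)) := by ring
      _ = _ := by rw [h1, one_mul]
  · exact (((intervalIntegral.intervalIntegrable_rpow' (a := 0) (b := a)
      (by linarith : -1 < β - γ - 1)).1).const_mul _)
  · filter_upwards [ae_restrict_mem measurableSet_Ioc] with ρ hρ
    have := hρ.1
    positivity

theorem rieszKernel_eq_lintegral {n : ℕ} {γ : ℝ} (hγ : 0 < γ) (v : Euc n) :
    ‖v‖ₑ ^ (-γ) = ∫⁻ ρ in Ioi ‖v‖, ENNReal.ofReal (γ * ρ ^ (-γ - 1)) := by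
  rcases eq_or_ne v 0 with rfl | hv
  · simp_rw [ENNReal.ofReal_mul hγ.le]
    rw [norm_zero, lintegral_const_mul _ (by fun_prop), lintegral_Ioi_rpow_eq_top, enorm_zero,
      ENNReal.zero_rpow_of_neg (by linarith), ENNReal.mul_top (by simpa using hγ)]
  · have hv' : 0 < ‖v‖ := norm_pos_iff.2 hv
    rw [lintegral_Ioi_rpow hγ hv', ← ofReal_norm, ENNReal.ofReal_rpow_of_pos hv']

theorem OrthGroup.norm_apply {n : ℕ} (g : OrthGroup n) (x : Euc n) : ‖g.1 x‖ = ‖x‖ :=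
  ContinuousLinearMap.norm_map_of_mem_unitary g.2 x

/-- The decay condition bounds the average of the Riesz kernel along the orbit of a point: the
layer cake formula reduces this to an integral over radii, which is split at the radius `‖z‖`. -/
theorem HasDecay.lintegral_rieszKernel_le {n : ℕ} {θ : Measure (OrthGroup n)} {β γ : ℝ}
    (hθ : HasDecay θ β) (hγ : 0 < γ) (hβ : γ < β) {x z : Euc n} (hx : x ≠ 0) (hz : z ≠ 0) :
    ∫⁻ g, ‖x - g.1 z‖ₑ ^ (-γ) ∂θ ≤ ENNReal.ofReal (β / (β - γ)) * ‖z‖ₑ ^ (-γ) := by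
  have hfin : IsFiniteMeasure θ := ⟨hθ.mass_le_one.trans_lt ENNReal.one_lt_top⟩
  have hz' : 0 < ‖z‖ := norm_pos_iff.2 hz
  have hc : Continuous fun g : OrthGroup n => x - g.1 z := by fun_prop
  have e1 : ∀ g : OrthGroup n, ‖x - g.1 z‖ₑ ^ (-γ) = ∫⁻ ρ in Ioi (0 : ℝ),
      ({q : OrthGroup n × ℝ | ‖x - q.1.1 z‖ < q.2}.indicator
        (fun q => ENNReal.ofReal (γ * q.2 ^ (-γ - 1)))) (g, ρ) := by
    intro g
    rw [rieszKernel_eq_lintegral hγ, ← lintegral_indicator measurableSet_Ioi,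
      ← lintegral_indicator measurableSet_Ioi]
    refine lintegral_congr fun ρ => ?_
    by_cases h : ‖x - g.1 z‖ < ρ
    · have : 0 < ρ := (norm_nonneg _).trans_lt h
      simp [indicator, h, this]
    · simp [indicator, h]
  have hset : MeasurableSet {q : OrthGroup n × ℝ | ‖x - q.1.1 z‖ < q.2} :=
    measurableSet_lt (hc.norm.measurable.comp measurable_fst) measurable_snd
  simp_rw [e1]
  rw [lintegral_lintegral_swap]
  swap
  · refine (Measurable.indicator ?_ hset).aemeasurable
    fun_prop
  have e2 : ∀ ρ : ℝ, ∫⁻ g, ({q : OrthGroup n × ℝ | ‖x - q.1.1 z‖ < q.2}.indicator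
        (fun q => ENNReal.ofReal (γ * q.2 ^ (-γ - 1)))) (g, ρ) ∂θ =
      ENNReal.ofReal (γ * ρ ^ (-γ - 1)) * θ {g | ‖x - g.1 z‖ < ρ} := by
    intro ρ
    have hs : MeasurableSet {g : OrthGroup n | ‖x - g.1 z‖ < ρ} :=
      measurableSet_lt hc.norm.measurable measurable_const
    rw [← lintegral_indicator_const hs]
    rfl
  simp_rw [e2]
  have hu : Ioi (0 : ℝ) = Ioc 0 ‖z‖ ∪ Ioi ‖z‖ := (Ioc_union_Ioi_eq_Ioi hz'.le).symm
  rw [hu, lintegral_union measurableSet_Ioi (Set.Ioc_disjoint_Ioi le_rfl)]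
  calc _ ≤ (∫⁻ ρ in Ioc 0 ‖z‖, ENNReal.ofReal (γ * ρ ^ (-γ - 1)) *
          ENNReal.ofReal ((ρ / ‖z‖) ^ β)) + ∫⁻ ρ in Ioi ‖z‖, ENNReal.ofReal (γ * ρ ^ (-γ - 1)) := by
        refine add_le_add (setLIntegral_mono' measurableSet_Ioc fun ρ hρ => ?_)
          (lintegral_mono fun ρ => ?_)
        · gcongr
          exact hθ.decay x z hx hz ρ hρ.1
        · exact mul_le_of_le_one_right' ((measure_mono (subset_univ _)).trans hθ.mass_le_one)
    _ = ENNReal.ofReal (γ / (β - γ) * ‖z‖ ^ (-γ)) + ENNReal.ofReal (‖z‖ ^ (-γ)) := by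
        rw [lintegral_Ioc_rpow hγ hβ hz', lintegral_Ioi_rpow hγ hz']
    _ = _ := by
        have : 0 < β - γ := by linarith
        have : 0 < β := by linarith
        rw [← ENNReal.ofReal_add (by positivity) (by positivity), ← ofReal_norm,
          ENNReal.ofReal_rpow_of_pos hz', ← ENNReal.ofReal_mul (by positivity)]
        congr 1
        field_simp
        ring

/-- Averaging the Riesz kernel of order `2n - s - t` over the orthogonal group decouples the two
points. -/
theorem HasDecay.lintegral_rieszKernel_le_mul {n : ℕ} {θ : Measure (OrthGroup n)} {β s t u : ℝ}
    (hθ : HasDecay θ β) (hs : 0 < s) (hsn : s < n) (ht : 0 < t) (htn : t < n) (hu : u = s + t - n)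
    (hβ : n - β < u) {x z : Euc n} (hx : x ≠ 0) (hz : z ≠ 0) :
    ∫⁻ g, ‖x - g.1 z‖ₑ ^ (u - n) ∂θ ≤
      ENNReal.ofReal (2 ^ (2 * n) * (β / (β + u - n))) * (‖x‖ₑ ^ (s - n) * ‖z‖ₑ ^ (t - n)) := by
  have hγ : 0 < n - u := by linarith
  have hβγ : n - u < β := by linarith
  have hx' : 0 < ‖x‖ := norm_pos_iff.2 hx
  have hz' : 0 < ‖z‖ := norm_pos_iff.2 hz
  have hB : 1 ≤ β / (β + u - n) := by
    rw [one_le_div (by linarith)]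
    linarith
  -- all exponents that occur are at most `2n`
  have hpow : ∀ a : ℝ, 0 ≤ a → a ≤ 2 * n → ∀ b : ℝ, 0 < b →
      (b / 2) ^ (-a) ≤ 2 ^ (2 * n) * b ^ (-a) := by
    intro a ha han b hb
    rw [Real.div_rpow hb.le zero_le_two, Real.rpow_neg zero_le_two, div_inv_eq_mul, mul_comm]
    gcongr
    calc (2 : ℝ) ^ a ≤ 2 ^ ((2 * n : ℕ) : ℝ) :=
          Real.rpow_le_rpow_of_exponent_le one_le_two (by push_cast; exact han)
      _ = 2 ^ (2 * n) := Real.rpow_natCast _ _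
  have hrhs : ENNReal.ofReal (2 ^ (2 * n) * (β / (β + u - n))) *
      (‖x‖ₑ ^ (s - n) * ‖z‖ₑ ^ (t - n)) =
      ENNReal.ofReal (2 ^ (2 * n) * (β / (β + u - n)) * (‖x‖ ^ (s - n) * ‖z‖ ^ (t - n))) := by
    rw [← ofReal_norm, ← ofReal_norm, ENNReal.ofReal_rpow_of_pos hx',
      ENNReal.ofReal_rpow_of_pos hz',
      ← ENNReal.ofReal_mul (by positivity), ← ENNReal.ofReal_mul (by positivity)]
  have hsplit : u - n = (s - n) + (t - n) := by linarith
  rcases le_or_gt (2 * ‖z‖) ‖x‖ with h | h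
  · -- the orbit of `z` stays away from `x`
    have h1 : ∀ g : OrthGroup n,
        ‖x - g.1 z‖ₑ ^ (u - n) ≤ ENNReal.ofReal ((‖x‖ / 2) ^ (u - n)) := by
      intro g
      have h2 : ‖x‖ / 2 ≤ ‖x - g.1 z‖ := by
        have := norm_sub_norm_le x (g.1 z)
        rw [OrthGroup.norm_apply] at this
        linarith
      have h3 : 0 < ‖x - g.1 z‖ := by linarith
      rw [← ofReal_norm, ENNReal.ofReal_rpow_of_pos h3]
      exact ENNReal.ofReal_le_ofReal
        (Real.rpow_le_rpow_of_nonpos (by positivity) h2 (by linarith))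
    calc ∫⁻ g, ‖x - g.1 z‖ₑ ^ (u - n) ∂θ
        ≤ ∫⁻ _, ENNReal.ofReal ((‖x‖ / 2) ^ (u - n)) ∂θ := lintegral_mono h1
      _ ≤ ENNReal.ofReal ((‖x‖ / 2) ^ (u - n)) := by
          rw [lintegral_const]
          exact mul_le_of_le_one_right' hθ.mass_le_one
      _ ≤ _ := by
          rw [hrhs]
          refine ENNReal.ofReal_le_ofReal ?_
          have h4 := hpow (n - u) hγ.le (by linarith) ‖x‖ hx'
          rw [neg_sub] at h4
          calc (‖x‖ / 2) ^ (u - n) ≤ 2 ^ (2 * n) * ‖x‖ ^ (u - n) := h4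
            _ = 2 ^ (2 * n) * 1 * (‖x‖ ^ (s - n) * ‖x‖ ^ (t - n)) := by
                rw [hsplit, Real.rpow_add hx', mul_one]
            _ ≤ _ := by
                gcongr 2 ^ (2 * n) * ?_ * (‖x‖ ^ (s - n) * ?_)
                exact Real.rpow_le_rpow_of_nonpos hz' (by linarith) (by linarith)
  · -- the decay condition controls the average by `‖z‖`, which is comparable to `‖x‖` or larger
    have h1 := hθ.lintegral_rieszKernel_le hγ hβγ hx hz
    rw [neg_sub, ← sub_add] at h1
    rw [show β + u - n = β - n + u by ring] at hrhs ⊢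
    refine h1.trans ?_
    rw [hrhs, ← ofReal_norm, ENNReal.ofReal_rpow_of_pos hz', ← ENNReal.ofReal_mul (by
      rw [show β + u - n = β - n + u by ring] at hB; linarith)]
    refine ENNReal.ofReal_le_ofReal ?_
    have h4 := hpow (n - s) (by linarith) (by linarith) ‖x‖ hx'
    rw [neg_sub] at h4
    have h5 : ‖z‖ ^ (s - n) ≤ (‖x‖ / 2) ^ (s - n) :=
      Real.rpow_le_rpow_of_nonpos (by positivity) (by linarith) (by linarith)
    have hB' : 0 ≤ β / (β - n + u) := by
      rw [show β - n + u = β + u - n by ring]; linarith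
    calc β / (β - n + u) * ‖z‖ ^ (u - n)
        = β / (β - n + u) * (‖z‖ ^ (s - n) * ‖z‖ ^ (t - n)) := by rw [hsplit, Real.rpow_add hz']
      _ ≤ β / (β - n + u) * ((2 ^ (2 * n) * ‖x‖ ^ (s - n)) * ‖z‖ ^ (t - n)) := by
          gcongr
          exact h5.trans h4
      _ = _ := by ring

/-! ### Disintegration with parameters -/

open ProbabilityTheory in
/-- Disintegration of a kernel with respect to a fixed σ-finite reference measure, jointly
measurable in the parameter and valid for every parameter at which the first marginal is absolutely
continuous. -/
theorem exists_kernel_disintegration {α β Ω : Type*} [MeasurableSpace α] [MeasurableSpace β]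
    [MeasurableSpace Ω] [MeasurableSpace.CountableOrCountablyGenerated α β] [StandardBorelSpace Ω]
    [Nonempty Ω] (κ : Kernel α (β × Ω)) [IsFiniteKernel κ] (m : Measure β) [SigmaFinite m] :
    ∃ Λ : Kernel (α × β) Ω, IsSFiniteKernel Λ ∧ (∀ p, IsFiniteMeasure (Λ p)) ∧
      ∀ a, κ.fst a ≪ m → κ a = m ⊗ₘ Λ.sectR a := by
  let η : Kernel α β := Kernel.const α m.toFinite
  -- Kernel Radon-Nikodym derivatives need finite reference measures, hence `m.toFinite`. Truncating
  -- to `NNReal` changes the density on a null set only and makes every slice finite.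
  let d : α × β → NNReal := fun p => (κ.fst.rnDeriv η p.1 p.2 * m.toFinite.rnDeriv m p.2).toNNReal
  have hd : Measurable d :=
    ((Kernel.measurable_rnDeriv κ.fst η).mul
      ((Measure.measurable_rnDeriv _ _).comp measurable_snd)).ennreal_toNNReal
  have hd' : Measurable (Function.uncurry fun (p : α × β) (_ : Ω) => (d p : ℝ≥0∞)) :=
    (measurable_coe_nnreal_ennreal.comp (hd.comp measurable_fst))
  have happ : ∀ p (s : Set Ω),
      Kernel.withDensity κ.condKernel (fun p _ => (d p : ℝ≥0∞)) p s = d p * κ.condKernel p s := by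
    intro p s
    rw [Kernel.withDensity_apply' _ hd', setLIntegral_const]
  refine ⟨Kernel.withDensity κ.condKernel fun p _ => (d p : ℝ≥0∞),
    Kernel.IsSFiniteKernel.withDensity _ fun _ _ => ENNReal.coe_ne_top, fun p => ⟨?_⟩,
    fun a ha => ?_⟩
  · rw [happ, measure_univ, mul_one]
    exact ENNReal.coe_lt_top
  · have : IsSFiniteKernel (Kernel.withDensity κ.condKernel fun p _ => (d p : ℝ≥0∞)) :=
      Kernel.IsSFiniteKernel.withDensity _ fun _ _ => ENNReal.coe_ne_top
    have hη : κ.fst a ≪ η a := ha.trans (absolutelyContinuous_toFinite m)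
    have hdm : κ.fst a = m.withDensity fun b => (d (a, b) : ℝ≥0∞) := by
      have h1 := Kernel.withDensity_rnDeriv_eq hη
      rw [Kernel.withDensity_apply _ (Kernel.measurable_rnDeriv _ _)] at h1
      have h2 : m.toFinite = m.withDensity (m.toFinite.rnDeriv m) :=
        (Measure.withDensity_rnDeriv_eq _ _ (toFinite_absolutelyContinuous m)).symm
      have h3 : η a = m.toFinite := rfl
      rw [← h1, h3]
      conv_lhs => rw [h2]
      rw [← withDensity_mul _ (Measure.measurable_rnDeriv _ _)
        (Kernel.measurable_rnDeriv_right _ _ _)]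
      refine withDensity_congr_ae ?_
      have h4 : ∀ᵐ b ∂m, m.toFinite.rnDeriv m b ≠ ⊤ := Measure.rnDeriv_ne_top _ _
      have h5 : ∀ᵐ b ∂m, κ.fst.rnDeriv η a b ≠ ⊤ :=
        (absolutelyContinuous_toFinite m).ae_le (Kernel.rnDeriv_ne_top κ.fst η (a := a))
      filter_upwards [h4, h5] with b h4 h5
      simp only [Pi.mul_apply, d]
      rw [ENNReal.coe_toNNReal (ENNReal.mul_ne_top h5 h4), mul_comm]
    ext s hs
    have h1 := congrArg (fun k : Kernel α (β × Ω) => k a s) (κ.disintegrate κ.condKernel)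
    beta_reduce at h1
    rw [← h1, Kernel.compProd_apply hs, Measure.compProd_apply hs, hdm,
      lintegral_withDensity_eq_lintegral_mul _ (by fun_prop)]
    · refine lintegral_congr fun b => ?_
      rw [Pi.mul_apply, Kernel.sectR_apply, happ]
    · exact Kernel.measurable_kernel_prodMk_left' hs a

theorem OrthGroup.apply_inv_apply {n : ℕ} (g : OrthGroup n) (x : Euc n) :
    g.1 ((g⁻¹ : OrthGroup n).1 x) = x := by
  have h : g * g⁻¹ = 1 := mul_inv_cancel g
  exact congrArg (fun a : OrthGroup n => a.1 x) h

theorem OrthGroup.inv_apply_apply {n : ℕ} (g : OrthGroup n) (x : Euc n) :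
    (g⁻¹ : OrthGroup n).1 (g.1 x) = x := by
  have h : g⁻¹ * g = 1 := inv_mul_cancel g
  exact congrArg (fun a : OrthGroup n => a.1 x) h

theorem OrthGroup.inner_apply_left {n : ℕ} (g : OrthGroup n) (x y : Euc n) :
    inner ℝ (g.1 x) y = inner ℝ x ((g⁻¹ : OrthGroup n).1 y) := by
  rw [show ((g⁻¹ : OrthGroup n).1) = ContinuousLinearMap.adjoint g.1 from rfl,
    ContinuousLinearMap.adjoint_inner_right]

theorem OrthGroup.measurePreserving {n : ℕ} (g : OrthGroup n) :
    MeasurePreserving (fun x : Euc n => g.1 x) :=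
  (Unitary.linearIsometryEquiv g).measurePreserving

theorem continuous_orthGroup_inv_apply {n : ℕ} :
    Continuous fun p : OrthGroup n × Euc n => (p.1⁻¹ : OrthGroup n).1 p.2 := by
  have : Continuous fun p : OrthGroup n × Euc n => (star p.1.1) p.2 := by fun_prop
  exact this

open ProbabilityTheory in
/-- The kernel sending `g` to the push-forward of `μ × ν` under `(x, y) ↦ (x - g y, x)`. -/
def differenceKernel {n : ℕ} (μ ν : Measure (Euc n)) : Kernel (OrthGroup n) (Euc n × Euc n) :=
  (Kernel.id ×ₖ Kernel.const (OrthGroup n) (μ.prod ν)).map fun q => (q.2.1 - q.1.1 q.2.2, q.2.1)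

theorem measurable_difference {n : ℕ} :
    Measurable fun q : OrthGroup n × (Euc n × Euc n) => (q.2.1 - q.1.1 q.2.2, q.2.1) := by
  have : Continuous fun q : OrthGroup n × (Euc n × Euc n) => (q.2.1 - q.1.1 q.2.2, q.2.1) := by
    fun_prop
  exact this.measurable

theorem differenceKernel_apply {n : ℕ} (μ ν : Measure (Euc n)) [IsFiniteMeasure μ]
    [IsFiniteMeasure ν] (g : OrthGroup n) :
    differenceKernel μ ν g = (μ.prod ν).map fun p => (p.1 - g.1 p.2, p.1) := by
  rw [differenceKernel, ProbabilityTheory.Kernel.map_apply _ measurable_difference,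
    ProbabilityTheory.Kernel.prod_apply, ProbabilityTheory.Kernel.id_apply,
    ProbabilityTheory.Kernel.const_apply, Measure.dirac_prod,
    Measure.map_map measurable_difference (by fun_prop)]
  rfl

instance isFiniteKernel_differenceKernel {n : ℕ} (μ ν : Measure (Euc n)) [IsFiniteMeasure μ]
    [IsFiniteMeasure ν] : ProbabilityTheory.IsFiniteKernel (differenceKernel μ ν) := by
  unfold differenceKernel
  exact ProbabilityTheory.Kernel.IsFiniteKernel.map _ _

theorem measurable_pairDiff {n : ℕ} (g : OrthGroup n) :
    Measurable fun p : Euc n × Euc n => p.1 - g.1 p.2 := by fun_prop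

theorem differenceKernel_fst_apply {n : ℕ} (μ ν : Measure (Euc n)) [IsFiniteMeasure μ]
    [IsFiniteMeasure ν] (g : OrthGroup n) :
    (differenceKernel μ ν).fst g = (μ.prod ν).map fun p => p.1 - g.1 p.2 := by
  rw [ProbabilityTheory.Kernel.fst_apply, differenceKernel_apply, Measure.map_map measurable_fst
    ((measurable_pairDiff g).prodMk measurable_fst)]
  rfl

/-! ### Fourier transforms of the slices -/

/-- The Fourier transform of the push-forward of `exp (-2πi⟪x, ξ⟫) d(μ × ν)(x, y)` under
`(x, y) ↦ x - g y`. -/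
def sliceFourier {n : ℕ} (μ ν : Measure (Euc n)) (g : OrthGroup n) (ξ η : Euc n) : ℂ :=
  ∫ p, chr p.1 ξ * chr (p.1 - g.1 p.2) η ∂(μ.prod ν)

theorem enorm_sliceFourier {n : ℕ} (μ ν : Measure (Euc n)) [IsFiniteMeasure μ] [IsFiniteMeasure ν]
    (g : OrthGroup n) (ξ η : Euc n) :
    ‖sliceFourier μ ν g ξ η‖ₑ ^ 2 =
      ‖ft μ (ξ + η)‖ₑ ^ 2 * ‖ft ν ((g⁻¹ : OrthGroup n).1 η)‖ₑ ^ 2 := by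
  have e : ∀ p : Euc n × Euc n, chr p.1 ξ * chr (p.1 - g.1 p.2) η =
      chr p.1 (ξ + η) * (starRingEnd ℂ) (chr p.2 ((g⁻¹ : OrthGroup n).1 η)) := by
    intro p
    rw [chr_sub_left, chr_add_right, mul_assoc]
    congr 3
    rw [chr, chr, OrthGroup.inner_apply_left]
  rw [sliceFourier]
  simp_rw [e]
  rw [integral_prod_mul (fun x => chr x (ξ + η))
    (fun y => (starRingEnd ℂ) (chr y ((g⁻¹ : OrthGroup n).1 η))), integral_conj, enorm_mul, mul_pow]
  simp only [← ofReal_norm, RCLike.norm_conj]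
  rfl

/-- The square integral of `sliceFourier μ ν g` with the weight `‖ξ‖ ^ r`. For `r = u - n` it
bounds the integral of the `u`-energies of the slices, up to a constant. -/
def sliceEnergy {n : ℕ} (r : ℝ) (μ ν : Measure (Euc n)) (g : OrthGroup n) : ℝ≥0∞ :=
  ∫⁻ ξ : Euc n, ‖ξ‖ₑ ^ r * ∫⁻ η, ‖sliceFourier μ ν g ξ η‖ₑ ^ 2

/-- The change of variables `ξ = x - g y`, `η = g y` in the weighted square integral. -/
theorem sliceEnergy_eq {n : ℕ} (r : ℝ) (μ ν : Measure (Euc n)) [IsFiniteMeasure μ]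
    [IsFiniteMeasure ν] (g : OrthGroup n) :
    sliceEnergy r μ ν g =
      ∫⁻ y, ∫⁻ x, ‖x - g.1 y‖ₑ ^ r * (‖ft μ x‖ₑ ^ 2 * ‖ft ν y‖ₑ ^ 2) := by
  have hμ : Measurable (ft μ) := (continuous_ft μ).measurable
  have hν : Measurable (ft ν) := (continuous_ft ν).measurable
  have hg : Measurable fun x : Euc n => (g⁻¹ : OrthGroup n).1 x := by fun_prop
  calc sliceEnergy r μ ν g
      = ∫⁻ ξ : Euc n, ∫⁻ η, ‖ξ‖ₑ ^ r *
          (‖ft μ (ξ + η)‖ₑ ^ 2 * ‖ft ν ((g⁻¹ : OrthGroup n).1 η)‖ₑ ^ 2) := by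
        refine lintegral_congr fun ξ => ?_
        rw [← lintegral_const_mul _ (by simp_rw [enorm_sliceFourier]; fun_prop)]
        simp_rw [enorm_sliceFourier]
    _ = ∫⁻ η, ∫⁻ ξ : Euc n, ‖ξ‖ₑ ^ r *
          (‖ft μ (ξ + η)‖ₑ ^ 2 * ‖ft ν ((g⁻¹ : OrthGroup n).1 η)‖ₑ ^ 2) :=
        lintegral_lintegral_swap (by fun_prop)
    _ = ∫⁻ η, ∫⁻ x : Euc n, ‖x - η‖ₑ ^ r *
          (‖ft μ x‖ₑ ^ 2 * ‖ft ν ((g⁻¹ : OrthGroup n).1 η)‖ₑ ^ 2) := by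
        refine lintegral_congr fun η => ?_
        rw [← lintegral_sub_right_eq_self _ η]
        simp_rw [sub_add_cancel]
    _ = _ := by
        rw [← g.measurePreserving.lintegral_comp
          (f := fun η => ∫⁻ x : Euc n, ‖x - η‖ₑ ^ r *
          (‖ft μ x‖ₑ ^ 2 * ‖ft ν ((g⁻¹ : OrthGroup n).1 η)‖ₑ ^ 2))
          (Measurable.lintegral_prod_right' (f := fun q : Euc n × Euc n => ‖q.2 - q.1‖ₑ ^ r *
          (‖ft μ q.2‖ₑ ^ 2 * ‖ft ν ((g⁻¹ : OrthGroup n).1 q.1)‖ₑ ^ 2)) (by fun_prop))]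
        simp_rw [OrthGroup.inv_apply_apply]

theorem measurable_riesz_orthGroup {n : ℕ} (r : ℝ) :
    Measurable fun q : (OrthGroup n × Euc n) × Euc n => ‖q.2 - q.1.1.1 q.1.2‖ₑ ^ r := by
  have : Continuous fun q : (OrthGroup n × Euc n) × Euc n => q.2 - q.1.1.1 q.1.2 := by fun_prop
  exact this.measurable.enorm.pow_const r

theorem measurable_sliceEnergy {n : ℕ} (r : ℝ) (μ ν : Measure (Euc n)) [IsFiniteMeasure μ]
    [IsFiniteMeasure ν] : Measurable (sliceEnergy r μ ν) := by
  have hμ : Measurable (ft μ) := (continuous_ft μ).measurable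
  have hν : Measurable (ft ν) := (continuous_ft ν).measurable
  have h := measurable_riesz_orthGroup (n := n) r
  have h1 : Measurable fun q : (OrthGroup n × Euc n) × Euc n =>
      ‖q.2 - q.1.1.1 q.1.2‖ₑ ^ r * (‖ft μ q.2‖ₑ ^ 2 * ‖ft ν q.1.2‖ₑ ^ 2) := h.mul (by fun_prop)
  have := (h1.lintegral_prod_right' (ν := volume)).lintegral_prod_right' (ν := volume)
  rw [show sliceEnergy r μ ν = _ from funext (sliceEnergy_eq r μ ν)]
  exact this

/-- The averaged weighted square integral is bounded by the product of the energies of `μ` and `ν`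
in their Fourier representations. -/
theorem HasDecay.lintegral_sliceEnergy_le {n : ℕ} {θ : Measure (OrthGroup n)} {β s t u : ℝ}
    (hθ : HasDecay θ β) (hs : 0 < s) (hsn : s < n) (ht : 0 < t) (htn : t < n) (hu : u = s + t - n)
    (hβ : n - β < u) (μ ν : Measure (Euc n)) [IsFiniteMeasure μ] [IsFiniteMeasure ν] :
    ∫⁻ g, sliceEnergy (u - n) μ ν g ∂θ ≤ ENNReal.ofReal (2 ^ (2 * n) * (β / (β + u - n))) *
      ((∫⁻ x : Euc n, ‖x‖ₑ ^ (s - n) * ‖ft μ x‖ₑ ^ 2) *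
        ∫⁻ y : Euc n, ‖y‖ₑ ^ (t - n) * ‖ft ν y‖ₑ ^ 2) := by
  have hfin : IsFiniteMeasure θ := ⟨hθ.mass_le_one.trans_lt ENNReal.one_lt_top⟩
  have hn : (0 : ℝ) < n := hs.trans hsn
  have hnt : Nontrivial (Euc n) := by
    have : 0 < n := by exact_mod_cast hn
    have : Nonempty (Fin n) := ⟨⟨0, this⟩⟩
    infer_instance
  have hμ : Measurable (ft μ) := (continuous_ft μ).measurable
  have hν : Measurable (ft ν) := (continuous_ft ν).measurable
  have h := measurable_riesz_orthGroup (n := n) (u - n)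
  have h1 : Measurable fun q : (OrthGroup n × Euc n) × Euc n =>
      ‖q.2 - q.1.1.1 q.1.2‖ₑ ^ (u - n) * (‖ft μ q.2‖ₑ ^ 2 * ‖ft ν q.1.2‖ₑ ^ 2) :=
    h.mul (by fun_prop)
  have hne : ∀ᵐ x : Euc n, x ≠ 0 := by
    simp [ae_iff]
  simp_rw [sliceEnergy_eq]
  rw [lintegral_lintegral_swap h1.lintegral_prod_right'.aemeasurable]
  calc ∫⁻ y, ∫⁻ g, ∫⁻ x, ‖x - g.1 y‖ₑ ^ (u - n) * (‖ft μ x‖ₑ ^ 2 * ‖ft ν y‖ₑ ^ 2) ∂volume ∂θ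
      = ∫⁻ y, ∫⁻ x, (∫⁻ g, ‖x - g.1 y‖ₑ ^ (u - n) ∂θ) * (‖ft μ x‖ₑ ^ 2 * ‖ft ν y‖ₑ ^ 2) := by
        refine lintegral_congr fun y => ?_
        have h2 : Measurable fun q : OrthGroup n × Euc n => ((q.1, y), q.2) := by fun_prop
        have h2' := h1.comp h2
        rw [lintegral_lintegral_swap (f := fun (g : OrthGroup n) (x : Euc n) =>
          ‖x - g.1 y‖ₑ ^ (u - n) * (‖ft μ x‖ₑ ^ 2 * ‖ft ν y‖ₑ ^ 2)) h2'.aemeasurable]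
        refine lintegral_congr fun x => ?_
        have h3 : Measurable fun g : OrthGroup n => ((g, y), x) := by fun_prop
        have h4 := h.comp h3
        exact lintegral_mul_const _ h4
    _ ≤ ∫⁻ y, ∫⁻ x, (ENNReal.ofReal (2 ^ (2 * n) * (β / (β + u - n))) *
          (‖x‖ₑ ^ (s - n) * ‖y‖ₑ ^ (t - n))) * (‖ft μ x‖ₑ ^ 2 * ‖ft ν y‖ₑ ^ 2) := by
        refine lintegral_mono_ae ?_
        filter_upwards [hne] with y hy
        refine lintegral_mono_ae ?_
        filter_upwards [hne] with x hx
        gcongr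
        exact hθ.lintegral_rieszKernel_le_mul hs hsn ht htn hu hβ hx hy
    _ = ∫⁻ y, ∫⁻ x, ENNReal.ofReal (2 ^ (2 * n) * (β / (β + u - n))) *
          ((‖x‖ₑ ^ (s - n) * ‖ft μ x‖ₑ ^ 2) * (‖y‖ₑ ^ (t - n) * ‖ft ν y‖ₑ ^ 2)) := by
        refine lintegral_congr fun y => lintegral_congr fun x => ?_
        ring
    _ = _ := by
        rw [← lintegral_const_mul _ (by fun_prop), ← lintegral_const_mul _ (by fun_prop)]
        refine lintegral_congr fun y => ?_
        rw [lintegral_const_mul _ (by fun_prop), lintegral_mul_const _ (by fun_prop)]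

/-- If the weighted square integral is finite, then the push-forward of `μ × ν` under
`(x, y) ↦ x - g y` is absolutely continuous. By finiteness, the push-forward of
`exp (-2πi⟪x, ξ⟫) d(μ × ν)` does not charge compact null sets for almost all `ξ`; then let `ξ` tend
to `0`. -/
theorem absolutelyContinuous_of_sliceEnergy_lt_top {n : ℕ} {r : ℝ} (hr : r < 0)
    (μ ν : Measure (Euc n)) [IsFiniteMeasure μ]
    [IsFiniteMeasure ν] {g : OrthGroup n} (hg : sliceEnergy r μ ν g < ⊤) :
    ((μ.prod ν).map fun p => p.1 - g.1 p.2) ≪ volume := by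
  set T : Euc n × Euc n → Euc n := fun p => p.1 - g.1 p.2 with hTdef
  have hT : Measurable T := measurable_pairDiff g
  have hJ : ∀ᵐ ξ : Euc n, ∫⁻ η, ‖sliceFourier μ ν g ξ η‖ₑ ^ 2 < ⊤ := by
    have hgi : Measurable fun x : Euc n => (g⁻¹ : OrthGroup n).1 x := by fun_prop
    have hμ : Measurable (ft μ) := (continuous_ft μ).measurable
    have hν : Measurable (ft ν) := (continuous_ft ν).measurable
    have hm : Measurable fun ξ : Euc n => ‖ξ‖ₑ ^ r * ∫⁻ η, ‖sliceFourier μ ν g ξ η‖ₑ ^ 2 := by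
      simp_rw [enorm_sliceFourier]
      fun_prop
    filter_upwards [ae_lt_top hm hg.ne] with ξ hξ
    refine ENNReal.lt_top_of_mul_ne_top_right hξ.ne ?_
    rw [Ne, ENNReal.rpow_eq_zero_iff]
    simp [hr.not_gt]
  have hcompact : ∀ K : Set (Euc n), IsCompact K → volume K = 0 →
      ((μ.prod ν).map T) K = 0 := by
    intro K hK hK0
    have h0 : ∀ᵐ ξ : Euc n, ∫ p in T ⁻¹' K, chr p.1 ξ ∂(μ.prod ν) = 0 := by
      filter_upwards [hJ] with ξ hξ
      have hm : Measurable fun p : Euc n × Euc n => chr p.1 ξ := by fun_prop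
      obtain ⟨G, hG, -, hGφ⟩ := exists_L2_density (μ.prod ν) hm (by simp) hT hξ
      exact integral_indicator_eq_zero_of_density (μ.prod ν) hm (by simp) hT hG hGφ hK hK0
    have hcont : Continuous fun ξ : Euc n => ∫ p in T ⁻¹' K, chr p.1 ξ ∂(μ.prod ν) := by
      refine continuous_of_dominated (bound := fun _ => 1) (fun ξ => ?_) (by simp)
        (integrable_const _) (.of_forall fun p => by fun_prop)
      have hm : Measurable fun p : Euc n × Euc n => chr p.1 ξ := by fun_prop
      exact hm.aestronglyMeasurable
    have h1 := (hcont.ae_eq_iff_eq volume continuous_const).1 h0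
    have h2 := congrFun h1 0
    simp only [chr_zero_right, integral_const, mul_one, measureReal_restrict_apply_univ,
      Complex.real_smul, Complex.ofReal_eq_zero] at h2
    rw [Measure.map_apply hT hK.measurableSet]
    exact (measureReal_eq_zero_iff).1 h2
  refine Measure.AbsolutelyContinuous.mk fun A hA hA0 => ?_
  rw [hA.measure_eq_iSup_isCompact]
  simp only [ENNReal.iSup_eq_zero]
  exact fun K hKA hK => hcompact K hK (measure_mono_null hKA hA0)

open ProbabilityTheory in
/-- Plancherel's theorem for the slices: as a function of the translation `z`, the Fourier transform
of the slice at a fixed frequency `ξ` has the Fourier transform `sliceFourier μ ν g ξ`. -/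
theorem lintegral_slice_ft_le {n : ℕ} (μ ν : Measure (Euc n)) [IsFiniteMeasure μ]
    [IsFiniteMeasure ν] (g : OrthGroup n) (Λ : ProbabilityTheory.Kernel (Euc n) (Euc n))
    [ProbabilityTheory.IsSFiniteKernel Λ]
    (hΛ : (μ.prod ν).map (fun p => (p.1 - g.1 p.2, p.1)) = volume ⊗ₘ Λ) (ξ : Euc n) :
    ∫⁻ z, ‖ft (Λ z) ξ‖ₑ ^ 2 ≤ ∫⁻ η, ‖sliceFourier μ ν g ξ η‖ₑ ^ 2 := by
  rcases eq_or_ne (∫⁻ η, ‖sliceFourier μ ν g ξ η‖ₑ ^ 2) ⊤ with h | h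
  · rw [h]
    exact le_top
  have hT := measurable_pairDiff g
  have hm : Measurable fun p : Euc n × Euc n => chr p.1 ξ := by fun_prop
  have hfin : IsFiniteMeasure ((volume : Measure (Euc n)) ⊗ₘ Λ) := by
    rw [← hΛ]
    infer_instance
  obtain ⟨G, hG, hGH, hGφ⟩ := exists_L2_density (μ.prod ν) hm (by simp) hT h.lt_top
  have hint : Integrable (fun q : Euc n × Euc n => chr q.2 ξ) (volume ⊗ₘ Λ) :=
    integrable_chr measurable_snd measurable_const
  have hF : Integrable fun z => ft (Λ z) ξ := hint.integral_compProd
  refine le_of_eq ((lintegral_sq_eq_of_density hF hG fun φ => ?_).trans hGH)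
  rw [← hGφ]
  have hi2 : Integrable (fun q : Euc n × Euc n => φ q.1 * chr q.2 ξ) (volume ⊗ₘ Λ) := by
    refine hint.bdd_mul (c := ‖φ.toBoundedContinuousFunction‖) ?_
      (.of_forall fun q => φ.toBoundedContinuousFunction.norm_coe_le_norm q.1)
    exact (φ.continuous.comp continuous_fst).aestronglyMeasurable
  have e1 : ∫ q, φ q.1 * chr q.2 ξ ∂(volume ⊗ₘ Λ) = ∫ z, φ z * ft (Λ z) ξ := by
    rw [Measure.integral_compProd hi2]
    refine integral_congr_ae (.of_forall fun z => ?_)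
    simp only [integral_const_mul]
    rfl
  rw [← e1, ← hΛ, integral_map (by fun_prop)]
  rw [hΛ]
  exact hi2.aestronglyMeasurable

/-! ### Weak convergence of the moved measures -/

theorem IsProfile.exists_bound {n : ℕ} {ψ : Euc n → ℝ} (hψ : IsProfile ψ) :
    ∃ M : ℝ, 0 ≤ M ∧ ∀ x, ψ x ≤ M := by
  have hc : HasCompactSupport ψ :=
    (isCompact_closedBall (0 : Euc n) 1).of_isClosed_subset (isClosed_tsupport _)
      hψ.tsupport_subset
  obtain ⟨M, hM⟩ := hc.exists_bound_of_continuous hψ.smooth.continuous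
  exact ⟨M, (norm_nonneg _).trans (hM 0), fun x => (le_abs_self _).trans (hM x)⟩

theorem IsProfile.approxId_nonneg {n : ℕ} {ψ : Euc n → ℝ} (hψ : IsProfile ψ) {ε : ℝ} (hε : 0 < ε)
    (x : Euc n) : 0 ≤ approxId ψ ε x :=
  mul_nonneg (by positivity) (hψ.nonneg _)

theorem IsProfile.norm_approxId_le {n : ℕ} {ψ : Euc n → ℝ} (hψ : IsProfile ψ) {M : ℝ}
    (hM : ∀ x, ψ x ≤ M) {ε : ℝ} (hε : 0 < ε) (x : Euc n) : ‖approxId ψ ε x‖ ≤ (ε ^ n)⁻¹ * M := by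
  rw [Real.norm_of_nonneg (hψ.approxId_nonneg hε _), approxId]
  gcongr
  exact hM _

theorem IsProfile.continuous_approxId {n : ℕ} {ψ : Euc n → ℝ} (hψ : IsProfile ψ) (ε : ℝ) :
    Continuous (approxId ψ ε) :=
  continuous_const.mul (hψ.smooth.continuous.comp (continuous_const_smul _))

theorem IsProfile.integral_approxId_comp {n : ℕ} {ψ : Euc n → ℝ} (hψ : IsProfile ψ) {ε : ℝ}
    (hε : 0 < ε) (g : OrthGroup n) (z : Euc n) :
    ∫ w, approxId ψ ε (g.1 (w - z)) = 1 := by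
  rw [integral_sub_right_eq_self (fun w => approxId ψ ε (g.1 w)) z]
  have h1 := (Unitary.linearIsometryEquiv g).measurePreserving.integral_comp
    (Unitary.linearIsometryEquiv g).toHomeomorph.measurableEmbedding (approxId ψ ε)
  refine h1.trans ?_
  simp only [approxId]
  rw [integral_const_mul, Measure.integral_comp_inv_smul_of_nonneg _ _ hε.le, hψ.integral_eq_one,
    finrank_euclideanSpace_fin, smul_eq_mul, mul_one, inv_mul_cancel₀ (by positivity)]

/-- Lebesgue differentiation for rotated approximate identities. -/
theorem IsProfile.ae_tendsto_integral_approxId {n : ℕ} {ψ : Euc n → ℝ} (hψ : IsProfile ψ)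
    (g : OrthGroup n) {F : Euc n → ℝ} (hF : Integrable F) :
    ∀ᵐ z, Tendsto (fun ε => ∫ w, approxId ψ ε (g.1 (w - z)) * F w) (𝓝[>] 0) (𝓝 (F z)) := by
  obtain ⟨M, hM0, hM⟩ := hψ.exists_bound
  filter_upwards [(Besicovitch.vitaliFamily (volume : Measure (Euc n))).ae_tendsto_average_norm_sub
    hF.locallyIntegrable] with z hz
  have hpos : ∀ᶠ ε : ℝ in 𝓝[>] 0, 0 < ε := self_mem_nhdsWithin
  have h1 := hz.comp (Besicovitch.tendsto_filterAt volume z)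
  refine tendsto_integral_smul_of_tendsto_average_norm_sub
    (M * (volume : Measure (Euc n)).real (Metric.closedBall 0 1)) h1
    (.of_forall fun ε => hF.integrableOn) ?_ ?_ ?_
  · refine tendsto_const_nhds.congr' ?_
    filter_upwards [hpos] with ε hε
    exact (hψ.integral_approxId_comp hε g z).symm
  · filter_upwards [hpos] with ε hε w hw
    have h2 : ψ (ε⁻¹ • g.1 (w - z)) ≠ 0 := right_ne_zero_of_mul hw
    have h3 := hψ.tsupport_subset (subset_tsupport _ h2)
    rw [mem_closedBall_zero_iff, norm_smul, OrthGroup.norm_apply, norm_inv,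
      Real.norm_of_nonneg hε.le, inv_mul_le_iff₀ hε, mul_one] at h3
    rwa [mem_closedBall_iff_norm]
  · filter_upwards [hpos] with ε hε w
    have hv : 0 < (volume : Measure (Euc n)).real (Metric.closedBall 0 1) :=
      ENNReal.toReal_pos (Metric.measure_closedBall_pos _ _ one_pos).ne'
        measure_closedBall_lt_top.ne
    rw [abs_of_nonneg (hψ.approxId_nonneg hε _), Measure.addHaar_real_closedBall' _ _ hε.le,
      finrank_euclideanSpace_fin, mul_div_mul_right _ _ hv.ne', approxId, inv_mul_eq_div]
    gcongr
    exact hM _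

theorem IsProfile.measurable_movedDensity {n : ℕ} {ψ : Euc n → ℝ} (hψ : IsProfile ψ)
    (ν : Measure (Euc n)) [IsFiniteMeasure ν] (g : OrthGroup n) (z : Euc n) (ε : ℝ) :
    Measurable (movedDensity ψ ν g z ε) := by
  have h := (hψ.continuous_approxId ε)
  have h1 : Continuous fun q : Euc n × Euc n =>
      approxId ψ ε ((g⁻¹ : OrthGroup n).1 q.1 - z - q.2) := by fun_prop
  exact (h1.stronglyMeasurable.integral_prod_right' (ν := ν)).measurable

theorem IsProfile.movedDensity_nonneg {n : ℕ} {ψ : Euc n → ℝ} (hψ : IsProfile ψ)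
    (ν : Measure (Euc n)) (g : OrthGroup n) (z : Euc n) {ε : ℝ} (hε : 0 < ε) (x : Euc n) :
    0 ≤ movedDensity ψ ν g z ε x :=
  integral_nonneg fun _ => hψ.approxId_nonneg hε _

theorem IsProfile.isFiniteMeasure_movedMeasure {n : ℕ} {ψ : Euc n → ℝ} (hψ : IsProfile ψ)
    (μ ν : Measure (Euc n)) [IsFiniteMeasure μ] [IsFiniteMeasure ν] (g : OrthGroup n)
    (z : Euc n) {ε : ℝ} (hε : 0 < ε) : IsFiniteMeasure (movedMeasure ψ ν μ g z ε) := by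
  obtain ⟨M, hM0, hM⟩ := hψ.exists_bound
  refine isFiniteMeasure_withDensity_ofReal (Integrable.hasFiniteIntegral ?_)
  refine Integrable.of_bound (hψ.measurable_movedDensity ν g z ε).aestronglyMeasurable
    ((ε ^ n)⁻¹ * M * ν.real univ) (.of_forall fun x => ?_)
  exact norm_integral_le_of_norm_le_const (.of_forall fun y => hψ.norm_approxId_le hM hε _)

theorem measurable_pairDiff_prodMk {n : ℕ} (g : OrthGroup n) :
    Measurable fun p : Euc n × Euc n => (p.1 - g.1 p.2, p.1) := by fun_prop

theorem IsProfile.measurable_approxId_mul {n : ℕ} {ψ : Euc n → ℝ} (hψ : IsProfile ψ) (ε : ℝ)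
    {φ : Euc n → ℝ} (hφ : Measurable φ) :
    Measurable fun q : (OrthGroup n × Euc n) × (Euc n × Euc n) =>
      approxId ψ ε ((q.1.1⁻¹ : OrthGroup n).1 (q.2.1 - q.1.1.1 q.2.2 - q.1.2)) * φ q.2.1 := by
  have h1 : Continuous fun q : (OrthGroup n × Euc n) × (Euc n × Euc n) =>
      (q.1.1⁻¹ : OrthGroup n).1 (q.2.1 - q.1.1.1 q.2.2 - q.1.2) := by
    have h2 : Continuous fun q : (OrthGroup n × Euc n) × (Euc n × Euc n) =>
      (q.1.1, q.2.1 - q.1.1.1 q.2.2 - q.1.2) := by fun_prop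
    have h3 := continuous_orthGroup_inv_apply.comp h2
    exact h3
  exact ((hψ.continuous_approxId ε).comp h1).measurable.mul
    (hφ.comp (measurable_fst.comp measurable_snd))

/-- Integrals with respect to the moved measures as double integrals. -/
theorem IsProfile.integral_movedMeasure_eq_prod {n : ℕ} {ψ : Euc n → ℝ} (hψ : IsProfile ψ)
    (μ ν : Measure (Euc n)) [IsFiniteMeasure μ] [IsFiniteMeasure ν] (g : OrthGroup n)
    {φ : Euc n → ℝ} (hφ : Measurable φ) {C : ℝ} (hC : ∀ x, ‖φ x‖ ≤ C) (z : Euc n) {ε : ℝ}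
    (hε : 0 < ε) :
    ∫ x, φ x ∂(movedMeasure ψ ν μ g ((g⁻¹ : OrthGroup n).1 z) ε) =
      ∫ p, approxId ψ ε ((g⁻¹ : OrthGroup n).1 (p.1 - g.1 p.2 - z)) * φ p.1 ∂(μ.prod ν) := by
  obtain ⟨M, hM0, hM⟩ := hψ.exists_bound
  have hi2 : Integrable (fun p : Euc n × Euc n =>
      approxId ψ ε ((g⁻¹ : OrthGroup n).1 (p.1 - g.1 p.2 - z)) * φ p.1) (μ.prod ν) := by
    have h1 : Measurable fun p : Euc n × Euc n => ((g, z), p) := by fun_prop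
    have h2 := (hψ.measurable_approxId_mul ε hφ).comp h1
    refine Integrable.of_bound h2.aestronglyMeasurable ((ε ^ n)⁻¹ * M * C)
      (.of_forall fun p => ?_)
    rw [norm_mul]
    gcongr
    · exact hψ.norm_approxId_le hM hε _
    · exact hC _
  rw [movedMeasure, integral_withDensity_eq_integral_toReal_smul
    (hψ.measurable_movedDensity ν g _ ε).ennreal_ofReal (.of_forall fun _ => ENNReal.ofReal_lt_top),
    integral_prod _ hi2]
  refine integral_congr_ae (.of_forall fun x => ?_)
  dsimp only
  rw [ENNReal.toReal_ofReal (hψ.movedDensity_nonneg ν g _ hε x), integral_mul_const,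
    smul_eq_mul, movedDensity, mollify]
  congr 2
  funext y
  congr 1
  rw [map_sub, map_sub, OrthGroup.inv_apply_apply]
  abel

open ProbabilityTheory in
/-- Integrals with respect to the moved measures are mollifications of the integrals with respect to
the slices. -/
theorem IsProfile.integral_movedMeasure {n : ℕ} {ψ : Euc n → ℝ} (hψ : IsProfile ψ)
    (μ ν : Measure (Euc n)) [IsFiniteMeasure μ] [IsFiniteMeasure ν] (g : OrthGroup n)
    (Λ : Kernel (Euc n) (Euc n)) [IsSFiniteKernel Λ]
    (hΛ : (μ.prod ν).map (fun p => (p.1 - g.1 p.2, p.1)) = volume ⊗ₘ Λ) {φ : Euc n → ℝ}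
    (hφ : Measurable φ) {C : ℝ} (hC : ∀ x, ‖φ x‖ ≤ C) (z : Euc n) {ε : ℝ} (hε : 0 < ε) :
    ∫ x, φ x ∂(movedMeasure ψ ν μ g ((g⁻¹ : OrthGroup n).1 z) ε) =
      ∫ w, approxId ψ ε ((g⁻¹ : OrthGroup n).1 (w - z)) * ∫ x, φ x ∂(Λ w) := by
  obtain ⟨M, hM0, hM⟩ := hψ.exists_bound
  have hfin : IsFiniteMeasure ((volume : Measure (Euc n)) ⊗ₘ Λ) := by
    rw [← hΛ]
    infer_instance
  have hac := hψ.continuous_approxId ε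
  have hm1 : Measurable fun q : Euc n × Euc n =>
      approxId ψ ε ((g⁻¹ : OrthGroup n).1 (q.1 - z)) * φ q.2 := by
    have : Continuous fun q : Euc n × Euc n => approxId ψ ε ((g⁻¹ : OrthGroup n).1 (q.1 - z)) := by
      fun_prop
    exact this.measurable.mul (hφ.comp measurable_snd)
  have hi1 : Integrable (fun q : Euc n × Euc n =>
      approxId ψ ε ((g⁻¹ : OrthGroup n).1 (q.1 - z)) * φ q.2) (volume ⊗ₘ Λ) := by
    refine Integrable.of_bound hm1.aestronglyMeasurable ((ε ^ n)⁻¹ * M * C)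
      (.of_forall fun q => ?_)
    rw [norm_mul]
    gcongr
    · exact hψ.norm_approxId_le hM hε _
    · exact hC _
  have e1 : ∫ q, approxId ψ ε ((g⁻¹ : OrthGroup n).1 (q.1 - z)) * φ q.2 ∂(volume ⊗ₘ Λ) =
      ∫ w, approxId ψ ε ((g⁻¹ : OrthGroup n).1 (w - z)) * ∫ x, φ x ∂(Λ w) := by
    rw [Measure.integral_compProd hi1]
    simp only [integral_const_mul]
  rw [← e1, ← hΛ, integral_map (measurable_pairDiff_prodMk g).aemeasurable
    hm1.aestronglyMeasurable, hψ.integral_movedMeasure_eq_prod μ ν g hφ hC z hε]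

/-- Integrals with respect to the moved measures depend continuously on the scale. -/
theorem IsProfile.continuousOn_integral_movedMeasure {n : ℕ} {ψ : Euc n → ℝ} (hψ : IsProfile ψ)
    (μ ν : Measure (Euc n)) [IsFiniteMeasure μ] [IsFiniteMeasure ν] (g : OrthGroup n)
    {φ : Euc n → ℝ} (hφ : Measurable φ) {C : ℝ} (hC : ∀ x, ‖φ x‖ ≤ C) (z : Euc n) :
    ContinuousOn (fun ε => ∫ x, φ x ∂(movedMeasure ψ ν μ g ((g⁻¹ : OrthGroup n).1 z) ε))
      (Ioi 0) := by
  obtain ⟨M, hM0, hM⟩ := hψ.exists_bound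
  refine ContinuousOn.congr (fun ε₀ hε₀ => ContinuousAt.continuousWithinAt ?_) fun ε hε =>
    hψ.integral_movedMeasure_eq_prod μ ν g hφ hC z hε
  have hε₀' : 0 < ε₀ := hε₀
  refine continuousAt_of_dominated (bound := fun _ => ((ε₀ / 2) ^ n)⁻¹ * M * C)
    (.of_forall fun ε => ?_) ?_ (integrable_const _) (.of_forall fun p => ?_)
  · have h1 : Measurable fun p : Euc n × Euc n => ((g, z), p) := by fun_prop
    have h2 := (hψ.measurable_approxId_mul ε hφ).comp h1
    exact h2.aestronglyMeasurable
  · filter_upwards [lt_mem_nhds (half_lt_self hε₀')] with ε hε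
    have hε0 : 0 < ε := (half_pos hε₀').trans hε
    refine .of_forall fun p => ?_
    rw [norm_mul]
    have h3 : (ε ^ n)⁻¹ * M ≤ ((ε₀ / 2) ^ n)⁻¹ * M := by gcongr
    gcongr
    · exact (hψ.norm_approxId_le hM hε0 _).trans h3
    · exact hC _
  · refine ContinuousAt.mul ?_ continuousAt_const
    have h4 := hψ.smooth.continuous
    unfold approxId
    refine ContinuousAt.mul ((continuousAt_id.pow n).inv₀ (pow_ne_zero n hε₀'.ne')) ?_
    exact h4.continuousAt.comp ((continuousAt_id.inv₀ hε₀'.ne').smul continuousAt_const)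

theorem IsProfile.measurable_integral_movedMeasure {n : ℕ} {ψ : Euc n → ℝ} (hψ : IsProfile ψ)
    (μ ν : Measure (Euc n)) [IsFiniteMeasure μ] [IsFiniteMeasure ν]
    {φ : Euc n → ℝ} (hφ : Measurable φ) {C : ℝ} (hC : ∀ x, ‖φ x‖ ≤ C) {ε : ℝ} (hε : 0 < ε) :
    Measurable fun p : OrthGroup n × Euc n =>
      ∫ x, φ x ∂(movedMeasure ψ ν μ p.1 ((p.1⁻¹ : OrthGroup n).1 p.2) ε) := by
  simp_rw [fun p : OrthGroup n × Euc n =>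
    hψ.integral_movedMeasure_eq_prod μ ν p.1 hφ hC p.2 hε]
  exact ((hψ.measurable_approxId_mul ε hφ).stronglyMeasurable.integral_prod_right'
    (ν := μ.prod ν)).measurable

/-- A one-sided limit of a continuous function may be computed along the rational numbers. -/
theorem tendsto_nhdsGT_zero_of_rat {f : ℝ → ℝ} {L : ℝ} (hf : ContinuousOn f (Ioi 0))
    (h : Tendsto (fun q : ℚ => f q) (comap ((↑) : ℚ → ℝ) (𝓝[>] 0)) (𝓝 L)) :
    Tendsto f (𝓝[>] 0) (𝓝 L) := by
  refine (closed_nhds_basis L).tendsto_right_iff.2 fun V hV => ?_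
  obtain ⟨U, hU, hUV⟩ := mem_comap.1 (h hV.1)
  obtain ⟨δ, hδ, hδU⟩ := mem_nhdsGT_iff_exists_Ioo_subset.1 hU
  filter_upwards [Ioo_mem_nhdsGT hδ] with x hx
  have hxc : x ∈ closure (Ioo 0 δ ∩ range ((↑) : ℚ → ℝ)) :=
    Rat.denseRange_cast.open_subset_closure_inter isOpen_Ioo hx
  have hc : ContinuousWithinAt f (Ioo 0 δ ∩ range ((↑) : ℚ → ℝ)) x :=
    (hf x hx.1).mono fun y hy => hy.1.1
  refine hV.2.closure_subset_iff.2 ?_ (hc.mem_closure_image hxc)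
  rintro _ ⟨_, ⟨hy, q, rfl⟩, rfl⟩
  exact hUV (hδU hy)

open ProbabilityTheory in
theorem IsProfile.ae_tendsto_integral_movedMeasure {n : ℕ} {ψ : Euc n → ℝ} (hψ : IsProfile ψ)
    (μ ν : Measure (Euc n)) [IsFiniteMeasure μ] [IsFiniteMeasure ν] (g : OrthGroup n)
    (Λ : Kernel (Euc n) (Euc n)) [IsSFiniteKernel Λ]
    (hΛ : (μ.prod ν).map (fun p => (p.1 - g.1 p.2, p.1)) = volume ⊗ₘ Λ) {φ : Euc n → ℝ}
    (hφ : Measurable φ) {C : ℝ} (hC : ∀ x, ‖φ x‖ ≤ C) :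
    ∀ᵐ z, Tendsto (fun ε => ∫ x, φ x ∂(movedMeasure ψ ν μ g ((g⁻¹ : OrthGroup n).1 z) ε))
      (𝓝[>] 0) (𝓝 (∫ x, φ x ∂(Λ z))) := by
  have hfin : IsFiniteMeasure ((volume : Measure (Euc n)) ⊗ₘ Λ) := by
    rw [← hΛ]
    infer_instance
  have hint : Integrable (fun q : Euc n × Euc n => φ q.2) (volume ⊗ₘ Λ) :=
    Integrable.of_bound (hφ.comp measurable_snd).aestronglyMeasurable C (.of_forall fun q => hC q.2)
  filter_upwards [hψ.ae_tendsto_integral_approxId g⁻¹ hint.integral_compProd] with z hz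
  refine hz.congr' ?_
  filter_upwards [self_mem_nhdsWithin] with ε hε
  exact (hψ.integral_movedMeasure μ ν g Λ hΛ hφ hC z hε).symm

open ProbabilityTheory in
/-- The slices live on the fibres of `(x, y) ↦ x - g y` over points of the supports. -/
theorem ae_slice_mem {n : ℕ} (μ ν : Measure (Euc n)) [IsFiniteMeasure μ] [IsFiniteMeasure ν]
    (g : OrthGroup n) (Λ : Kernel (Euc n) (Euc n)) [IsSFiniteKernel Λ]
    (hΛ : (μ.prod ν).map (fun p => (p.1 - g.1 p.2, p.1)) = volume ⊗ₘ Λ) :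
    ∀ᵐ z, ∀ᵐ x ∂(Λ z), x ∈ μ.support ∧ (g⁻¹ : OrthGroup n).1 (x - z) ∈ ν.support := by
  refine Measure.ae_ae_of_ae_compProd
    (p := fun q : Euc n × Euc n =>
      q.2 ∈ μ.support ∧ (g⁻¹ : OrthGroup n).1 (q.2 - q.1) ∈ ν.support) ?_
  have hcl : IsClosed {q : Euc n × Euc n |
      q.2 ∈ μ.support ∧ (g⁻¹ : OrthGroup n).1 (q.2 - q.1) ∈ ν.support} :=
    (Measure.isClosed_support.preimage continuous_snd).inter
      (Measure.isClosed_support.preimage (by fun_prop))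
  rw [← hΛ, ae_map_iff (by fun_prop) hcl.measurableSet]
  have h1 : ∀ᵐ p ∂(μ.prod ν), p.1 ∈ μ.support :=
    Measure.quasiMeasurePreserving_fst.ae Measure.support_mem_ae
  have h2 : ∀ᵐ p ∂(μ.prod ν), p.2 ∈ ν.support :=
    Measure.quasiMeasurePreserving_snd.ae Measure.support_mem_ae
  filter_upwards [h1, h2] with p h1 h2
  refine ⟨h1, ?_⟩
  rwa [sub_sub_cancel, OrthGroup.inv_apply_apply]

theorem support_subset_of_ae_mem {n : ℕ} {μ ν l : Measure (Euc n)} {g : OrthGroup n} {z : Euc n}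
    (h : ∀ᵐ x ∂l, x ∈ μ.support ∧ (g⁻¹ : OrthGroup n).1 (x - z) ∈ ν.support) :
    l.support ⊆ μ.support ∩ (fun x => g.1 x + z) '' ν.support := by
  have hcl : IsClosed {x : Euc n | x ∈ μ.support ∧ (g⁻¹ : OrthGroup n).1 (x - z) ∈ ν.support} :=
    Measure.isClosed_support.inter (Measure.isClosed_support.preimage (by fun_prop))
  refine (Measure.support_subset_of_isClosed hcl h).trans fun x hx => ⟨hx.1, _, hx.2, ?_⟩
  simp only [OrthGroup.apply_inv_apply, sub_add_cancel]

theorem norm_integral_sub_le_of_ae {n : ℕ} {m : Measure (Euc n)} [IsFiniteMeasure m]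
    {φ d : Euc n → ℝ} (hφ : Integrable φ m) (hd : Integrable d m) {δ : ℝ}
    (h : ∀ᵐ x ∂m, ‖φ x - d x‖ ≤ δ) :
    |(∫ x, φ x ∂m) - ∫ x, d x ∂m| ≤ δ * m.real univ := by
  rw [← integral_sub hφ hd, ← Real.norm_eq_abs]
  exact norm_integral_le_of_norm_le_const h

/-- A continuous function on a set, extended by zero. -/
def zeroExtend {n : ℕ} {K : Set (Euc n)} (d : C(K, ℝ)) : Euc n → ℝ :=
  Function.extend Subtype.val d 0

theorem measurable_zeroExtend {n : ℕ} {K : Set (Euc n)} (hK : MeasurableSet K) (d : C(K, ℝ)) :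
    Measurable (zeroExtend d) :=
  (MeasurableEmbedding.subtype_coe hK).measurable_extend d.continuous.measurable measurable_const

theorem zeroExtend_apply {n : ℕ} {K : Set (Euc n)} (d : C(K, ℝ)) (x : K) :
    zeroExtend d x = d x :=
  Subtype.val_injective.extend_apply _ _ _

theorem norm_zeroExtend_le {n : ℕ} {K : Set (Euc n)} [CompactSpace K] (d : C(K, ℝ)) (x : Euc n) :
    ‖zeroExtend d x‖ ≤ ‖d‖ := by
  by_cases hx : x ∈ K
  · exact (zeroExtend_apply d ⟨x, hx⟩).symm ▸ d.norm_coe_le_norm ⟨x, hx⟩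
  · rw [zeroExtend, Function.extend_apply' _ _ _ (by rintro ⟨y, rfl⟩; exact hx y.2)]
    simp

open ProbabilityTheory in
/-- Almost everywhere convergence for a fixed test function, jointly in the rotation and the
translation. The exceptional set is measurable because the limit may be taken along the
rationals. -/
theorem IsProfile.ae_prod_tendsto_integral_movedMeasure {n : ℕ} {ψ : Euc n → ℝ}
    (hψ : IsProfile ψ) (θ : Measure (OrthGroup n)) [IsFiniteMeasure θ]
    (μ ν : Measure (Euc n)) [IsFiniteMeasure μ] [IsFiniteMeasure ν]
    (Λ : Kernel (OrthGroup n × Euc n) (Euc n)) [IsSFiniteKernel Λ]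
    (hΛ : ∀ᵐ g ∂θ, (μ.prod ν).map (fun p => (p.1 - g.1 p.2, p.1)) = volume ⊗ₘ Λ.sectR g)
    {φ : Euc n → ℝ} (hφ : Measurable φ) {C : ℝ} (hC : ∀ x, ‖φ x‖ ≤ C) :
    ∀ᵐ p ∂(θ.prod volume),
      Tendsto (fun ε => ∫ x, φ x ∂(movedMeasure ψ ν μ p.1 ((p.1⁻¹ : OrthGroup n).1 p.2) ε))
        (𝓝[>] 0) (𝓝 (∫ x, φ x ∂(Λ p))) := by
  -- replacing non-positive scales by `1` makes the functions measurable for all rational scales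
  have hm : ∀ q : ℚ, Measurable fun p : OrthGroup n × Euc n => ∫ x, φ x
      ∂(movedMeasure ψ ν μ p.1 ((p.1⁻¹ : OrthGroup n).1 p.2)
        (if 0 < (q : ℝ) then (q : ℝ) else 1)) :=
    fun q => hψ.measurable_integral_movedMeasure μ ν hφ hC (by split_ifs with h <;> simp [*])
  have hL : Measurable fun p => ∫ x, φ x ∂(Λ p) := by
    have : StronglyMeasurable fun q : (OrthGroup n × Euc n) × Euc n => φ q.2 :=
      (hφ.comp measurable_snd).stronglyMeasurable
    exact this.integral_kernel_prod_right'.measurable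
  have hS := measurableSet_tendsto_fun (l := comap ((↑) : ℚ → ℝ) (𝓝[>] 0)) hm hL
  have hcongr : ∀ p : OrthGroup n × Euc n, (fun q : ℚ => ∫ x, φ x
      ∂(movedMeasure ψ ν μ p.1 ((p.1⁻¹ : OrthGroup n).1 p.2)
        (if 0 < (q : ℝ) then (q : ℝ) else 1)))
      =ᶠ[comap ((↑) : ℚ → ℝ) (𝓝[>] 0)]
      fun q : ℚ => ∫ x, φ x ∂(movedMeasure ψ ν μ p.1 ((p.1⁻¹ : OrthGroup n).1 p.2) q) := by
    intro p
    filter_upwards [preimage_mem_comap self_mem_nhdsWithin] with q hq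
    rw [if_pos (show 0 < (q : ℝ) from hq)]
  have key : ∀ᵐ p ∂(θ.prod volume), Tendsto (fun q : ℚ => ∫ x, φ x
      ∂(movedMeasure ψ ν μ p.1 ((p.1⁻¹ : OrthGroup n).1 p.2)
        (if 0 < (q : ℝ) then (q : ℝ) else 1)))
      (comap ((↑) : ℚ → ℝ) (𝓝[>] 0)) (𝓝 (∫ x, φ x ∂(Λ p))) := by
    refine (Measure.ae_prod_iff_ae_ae hS).2 ?_
    filter_upwards [hΛ] with g hg
    filter_upwards [hψ.ae_tendsto_integral_movedMeasure μ ν g (Λ.sectR g) hg hφ hC] with z hz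
    exact (hz.comp tendsto_comap).congr' (hcongr (g, z)).symm
  filter_upwards [key] with p hp
  exact tendsto_nhdsGT_zero_of_rat (hψ.continuousOn_integral_movedMeasure μ ν p.1 hφ hC p.2)
    (hp.congr' (hcongr p))

open ProbabilityTheory in
theorem ae_prod_slice_mem {n : ℕ} (θ : Measure (OrthGroup n)) [IsFiniteMeasure θ]
    (μ ν : Measure (Euc n)) [IsFiniteMeasure μ] [IsFiniteMeasure ν]
    (Λ : Kernel (OrthGroup n × Euc n) (Euc n)) [IsSFiniteKernel Λ]
    (hΛ : ∀ᵐ g ∂θ, (μ.prod ν).map (fun p => (p.1 - g.1 p.2, p.1)) = volume ⊗ₘ Λ.sectR g) :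
    ∀ᵐ p ∂(θ.prod volume), ∀ᵐ x ∂(Λ p),
      x ∈ μ.support ∧ (p.1⁻¹ : OrthGroup n).1 (x - p.2) ∈ ν.support := by
  have hc : Continuous fun q : (OrthGroup n × Euc n) × Euc n =>
      (q.1.1⁻¹ : OrthGroup n).1 (q.2 - q.1.2) := by
    have h2 : Continuous fun q : (OrthGroup n × Euc n) × Euc n => (q.1.1, q.2 - q.1.2) := by
      fun_prop
    have h3 := continuous_orthGroup_inv_apply.comp h2
    exact h3
  have hcl : IsClosed {q : (OrthGroup n × Euc n) × Euc n |
      q.2 ∈ μ.support ∧ (q.1.1⁻¹ : OrthGroup n).1 (q.2 - q.1.2) ∈ ν.support} :=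
    (Measure.isClosed_support.preimage continuous_snd).inter (Measure.isClosed_support.preimage hc)
  have hS := (Kernel.measurable_kernel_prodMk_left (κ := Λ) hcl.measurableSet.compl)
    (measurableSet_singleton 0)
  refine (Measure.ae_prod_iff_ae_ae hS).2 ?_
  filter_upwards [hΛ] with g hg using ae_slice_mem μ ν g (Λ.sectR g) hg

open ProbabilityTheory in
/-- Weak convergence of the moved measures to the slices at almost every point: it is enough to test
countably many functions, dense among the continuous functions on the support of `μ`. -/
theorem IsProfile.ae_prod_weaklyConverges {n : ℕ} {ψ : Euc n → ℝ} (hψ : IsProfile ψ)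
    (θ : Measure (OrthGroup n)) [IsFiniteMeasure θ]
    (μ ν : Measure (Euc n)) [IsFiniteMeasure μ] [IsFiniteMeasure ν] (hμ : IsCompact μ.support)
    (Λ : Kernel (OrthGroup n × Euc n) (Euc n)) [IsSFiniteKernel Λ]
    (hΛf : ∀ p, IsFiniteMeasure (Λ p))
    (hΛ : ∀ᵐ g ∂θ, (μ.prod ν).map (fun p => (p.1 - g.1 p.2, p.1)) = volume ⊗ₘ Λ.sectR g) :
    ∀ᵐ p ∂(θ.prod volume),
      WeaklyConverges (fun ε => movedMeasure ψ ν μ p.1 ((p.1⁻¹ : OrthGroup n).1 p.2) ε) (Λ p) := by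
  have hKm : MeasurableSet μ.support := hμ.measurableSet
  have : CompactSpace μ.support := isCompact_iff_compactSpace.1 hμ
  obtain ⟨D, hDc, hDd⟩ := TopologicalSpace.exists_countable_dense C(μ.support, ℝ)
  have h1 : ∀ᵐ p ∂(θ.prod volume), ∀ d ∈ D, Tendsto
      (fun ε => ∫ x, zeroExtend d x ∂(movedMeasure ψ ν μ p.1 ((p.1⁻¹ : OrthGroup n).1 p.2) ε))
      (𝓝[>] 0) (𝓝 (∫ x, zeroExtend d x ∂(Λ p))) :=
    (ae_ball_iff hDc).2 fun d _ => hψ.ae_prod_tendsto_integral_movedMeasure θ μ ν Λ hΛ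
      (measurable_zeroExtend hKm d) (norm_zeroExtend_le d)
  have h2 := hψ.ae_prod_tendsto_integral_movedMeasure θ μ ν Λ hΛ (φ := fun _ => 1) measurable_const
    (C := 1) (by simp)
  filter_upwards [h1, h2, ae_prod_slice_mem θ μ ν Λ hΛ] with p h1 h2 h3 φ hφ hφc
  have := hΛf p
  simp only [integral_const, smul_eq_mul, mul_one] at h2
  obtain ⟨C, hC⟩ := hφc.exists_bound_of_continuous hφ
  set A := (Λ p).real univ + 1 with hA
  have hA0 : 0 < A := by positivity
  rw [Metric.tendsto_nhds]
  intro η hη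
  let φK : C(μ.support, ℝ) := ⟨fun x => φ x, hφ.comp continuous_subtype_val⟩
  have hδ : 0 < η / (4 * A) := by positivity
  obtain ⟨d, hd, hdD⟩ := hDd.exists_dist_lt φK hδ
  have hclose : ∀ x ∈ μ.support, ‖φ x - zeroExtend d x‖ ≤ η / (4 * A) := by
    intro x hx
    have e := zeroExtend_apply d ⟨x, hx⟩
    simp only at e
    rw [e]
    have := ContinuousMap.dist_apply_le_dist (f := φK) (g := d) ⟨x, hx⟩
    rw [dist_eq_norm] at this
    exact this.trans hdD.le
  have hint : ∀ m : Measure (Euc n), IsFiniteMeasure m → (∀ᵐ x ∂m, x ∈ μ.support) →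
      |(∫ x, φ x ∂m) - ∫ x, zeroExtend d x ∂m| ≤ η / (4 * A) * m.real univ := by
    intro m hm hmK
    refine norm_integral_sub_le_of_ae
      (Integrable.of_bound hφ.aestronglyMeasurable C (.of_forall hC))
      (Integrable.of_bound (measurable_zeroExtend hKm d).aestronglyMeasurable ‖d‖
        (.of_forall (norm_zeroExtend_le d))) ?_
    filter_upwards [hmK] with x hx using hclose x hx
  filter_upwards [self_mem_nhdsWithin, (tendsto_order.1 h2).2 A (by simp [hA]),
    Metric.tendsto_nhds.1 (h1 d hd) (η / 2) (half_pos hη)] with ε hε hmass hconv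
  have hfm := hψ.isFiniteMeasure_movedMeasure μ ν p.1 ((p.1⁻¹ : OrthGroup n).1 p.2) hε
  have b1 := hint _ hfm ((withDensity_absolutelyContinuous μ _).ae_le Measure.support_mem_ae)
  have b2 := hint (Λ p) (hΛf p) (h3.mono fun x hx => hx.1)
  have b3 : η / (4 * A) *
      (movedMeasure ψ ν μ p.1 ((p.1⁻¹ : OrthGroup n).1 p.2) ε).real univ ≤ η / 4 := by
    calc _ ≤ η / (4 * A) * A := by gcongr
      _ = η / 4 := by field_simp
  have b4 : η / (4 * A) * (Λ p).real univ ≤ η / 4 := by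
    calc _ ≤ η / (4 * A) * A := by gcongr; simp [hA]
      _ = η / 4 := by field_simp
  rw [Real.dist_eq, abs_lt] at hconv ⊢
  rw [abs_le] at b1 b2
  constructor <;> linarith [hconv.1, hconv.2, b1.1, b1.2, b2.1, b2.2]

/-! ### Energies of the slices -/

open ProbabilityTheory in
theorem measurable_energy_kernel {α : Type*} [MeasurableSpace α] {n : ℕ} (u : ℝ)
    (Λ : Kernel α (Euc n)) [IsSFiniteKernel Λ] : Measurable fun p => energy u (Λ p) := by
  have h : Measurable fun q : (α × Euc n) × Euc n => ‖q.1.2 - q.2‖ₑ ^ (-u) := by fun_prop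
  have h1 : Measurable fun q : α × Euc n => ∫⁻ y, ‖q.2 - y‖ₑ ^ (-u) ∂(Λ q.1) :=
    h.lintegral_kernel_prod_right' (κ := Kernel.prodMkRight (Euc n) Λ)
  exact h1.lintegral_kernel_prod_right'

open ProbabilityTheory in
theorem measurable_ft_kernel {α : Type*} [MeasurableSpace α] {n : ℕ}
    (Λ : Kernel α (Euc n)) [IsSFiniteKernel Λ] :
    Measurable fun q : α × Euc n => ft (Λ q.1) q.2 := by
  have h : StronglyMeasurable fun q : (α × Euc n) × Euc n => chr q.2 q.1.2 :=
    Measurable.stronglyMeasurable (by fun_prop)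
  exact (h.integral_kernel_prod_right' (κ := Kernel.prodMkRight (Euc n) Λ)).measurable

open ProbabilityTheory in
/-- The energies of the slices, integrated over all translations. -/
theorem lintegral_energy_slice_le {n : ℕ} {u c : ℝ}
    (hc : ∀ m : Measure (Euc n), IsFiniteMeasure m →
      energy u m = ENNReal.ofReal c * ∫⁻ ξ : Euc n, ‖ξ‖ₑ ^ (u - n) * ‖ft m ξ‖ₑ ^ 2)
    (μ ν : Measure (Euc n)) [IsFiniteMeasure μ]
    [IsFiniteMeasure ν] (g : OrthGroup n) (Λ : Kernel (Euc n) (Euc n))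
    [IsSFiniteKernel Λ] (hΛf : ∀ z, IsFiniteMeasure (Λ z))
    (hΛ : (μ.prod ν).map (fun p => (p.1 - g.1 p.2, p.1)) = volume ⊗ₘ Λ) :
    ∫⁻ z, energy u (Λ z) ≤ ENNReal.ofReal c * sliceEnergy (u - n) μ ν g := by
  have hm := measurable_ft_kernel Λ
  have hm1 : Measurable fun q : Euc n × Euc n => ‖q.2‖ₑ ^ (u - n) * ‖ft (Λ q.1) q.2‖ₑ ^ 2 :=
    (by fun_prop : Measurable fun q : Euc n × Euc n => ‖q.2‖ₑ ^ (u - n)).mul (hm.enorm.pow_const 2)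
  calc ∫⁻ z, energy u (Λ z)
      = ENNReal.ofReal c * ∫⁻ z, ∫⁻ ξ : Euc n, ‖ξ‖ₑ ^ (u - n) * ‖ft (Λ z) ξ‖ₑ ^ 2 := by
        rw [← lintegral_const_mul _ hm1.lintegral_prod_right']
        exact lintegral_congr fun z => hc (Λ z) (hΛf z)
    _ = ENNReal.ofReal c * ∫⁻ ξ : Euc n, ‖ξ‖ₑ ^ (u - n) * ∫⁻ z, ‖ft (Λ z) ξ‖ₑ ^ 2 := by
        rw [lintegral_lintegral_swap hm1.aemeasurable]
        congr 1
        refine lintegral_congr fun ξ => ?_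
        have h1 : Measurable fun z : Euc n => (z, ξ) := by fun_prop
        have h2 := (hm.comp h1).enorm.pow_const 2
        exact lintegral_const_mul _ h2
    _ ≤ _ := by
        rw [sliceEnergy]
        refine mul_le_mul_right (lintegral_mono fun ξ => mul_le_mul_right ?_ _) _
        exact lintegral_slice_ft_le μ ν g Λ hΛ ξ

theorem IsRadonCompactSupport.isFiniteMeasure {n : ℕ} {μ : Measure (Euc n)}
    (hμ : IsRadonCompactSupport μ) : IsFiniteMeasure μ := by
  have := hμ.locallyFinite
  refine ⟨?_⟩
  rw [← measure_add_measure_compl (Measure.isClosed_support (μ := μ)).measurableSet,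
    Measure.measure_compl_support, add_zero]
  exact hμ.isCompact_support.measure_lt_top

end

theorem mainTheorem2 (n : ℕ) (s t u : ℝ) (hs : 0 < s) (hsn : s < n) (ht : 0 < t) (htn : t < n)
    (hu : u = s + t - n) (hu0 : 0 < u) :
    ∃ C : ℝ, 0 < C ∧
      ∀ (β : ℝ), 0 < β → n - β < u →
      ∀ θ : Measure (OrthGroup n), IsRadonCompactSupport θ → HasDecay θ β →
      ∀ μ ν : Measure (Euc n), IsRadonCompactSupport μ → IsRadonCompactSupport ν →
        energy s μ < ⊤ → energy t ν < ⊤ →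
      ∀ ψ : Euc n → ℝ, IsProfile ψ →
      ∃ lam : OrthGroup n → Euc n → Measure (Euc n),
        (∀ᵐ p ∂(θ.prod (volume : Measure (Euc n))),
          IsLocallyFiniteMeasure (lam p.1 p.2) ∧
          WeaklyConverges
            (fun ε => movedMeasure ψ ν μ p.1 ((p.1⁻¹ : OrthGroup n).1 p.2) ε) (lam p.1 p.2) ∧
          (lam p.1 p.2).support ⊆ μ.support ∩ (fun x => p.1.1 x + p.2) '' ν.support) ∧
        (∀ᵐ g ∂θ, AEMeasurable (fun z => lam g z univ) volume ∧
          ∫⁻ z, lam g z univ = μ univ * ν univ) ∧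
        AEMeasurable (fun p : OrthGroup n × Euc n => energy u (lam p.1 p.2))
          (θ.prod (volume : Measure (Euc n))) ∧
        ∫⁻ g, (∫⁻ z, energy u (lam g z)) ∂θ ≤
          ENNReal.ofReal (C * (β / (β + u - n))) * energy s μ * energy t ν := by
  obtain ⟨cs, hcs0, hcs⟩ := exists_energy_eq_lintegral_ft hs hsn
  obtain ⟨ct, hct0, hct⟩ := exists_energy_eq_lintegral_ft ht htn
  obtain ⟨cu, hcu0, hcu⟩ := exists_energy_eq_lintegral_ft (n := n) hu0 (by linarith)
  refine ⟨cu * 2 ^ (2 * n) * cs⁻¹ * ct⁻¹, by positivity, ?_⟩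
  intro β hβ hβu θ hθ hdecay μ ν hμ hν hEμ hEν ψ hψ
  have hμf := hμ.isFiniteMeasure
  have hνf := hν.isFiniteMeasure
  have hθf : IsFiniteMeasure θ := ⟨hdecay.mass_le_one.trans_lt ENNReal.one_lt_top⟩
  obtain ⟨Λ, hΛs, hΛf, hΛ⟩ := exists_kernel_disintegration (differenceKernel μ ν) volume
  have hsect : ∀ g : OrthGroup n, ProbabilityTheory.IsSFiniteKernel (Λ.sectR g) :=
    fun g => inferInstance
  have hB : 0 ≤ β / (β + u - n) := div_nonneg hβ.le (by linarith)
  -- the energies in the Fourier representation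
  set Es := ∫⁻ x : Euc n, ‖x‖ₑ ^ (s - n) * ‖ft μ x‖ₑ ^ 2 with hEs
  set Et := ∫⁻ y : Euc n, ‖y‖ₑ ^ (t - n) * ‖ft ν y‖ₑ ^ 2 with hEt
  have hEs' : Es = ENNReal.ofReal cs⁻¹ * energy s μ := by
    rw [hcs μ hμf, ← mul_assoc, ← ENNReal.ofReal_mul (by positivity), inv_mul_cancel₀ hcs0.ne',
      ENNReal.ofReal_one, one_mul]
  have hEt' : Et = ENNReal.ofReal ct⁻¹ * energy t ν := by
    rw [hct ν hνf, ← mul_assoc, ← ENNReal.ofReal_mul (by positivity), inv_mul_cancel₀ hct0.ne',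
      ENNReal.ofReal_one, one_mul]
  have hslice := hdecay.lintegral_sliceEnergy_le hs hsn ht htn hu hβu μ ν
  have hslice_top : ∫⁻ g, sliceEnergy (u - n) μ ν g ∂θ ≠ ⊤ := by
    refine ne_top_of_le_ne_top ?_ hslice
    rw [← hEs, ← hEt, hEs', hEt']
    exact ENNReal.mul_ne_top ENNReal.ofReal_ne_top
      (ENNReal.mul_ne_top (ENNReal.mul_ne_top ENNReal.ofReal_ne_top hEμ.ne)
        (ENNReal.mul_ne_top ENNReal.ofReal_ne_top hEν.ne))
  -- for almost all `g`, the kernel `Λ` disintegrates the push-forward of `μ × ν`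
  have hgood : ∀ᵐ g ∂θ,
      (μ.prod ν).map (fun p => (p.1 - g.1 p.2, p.1)) =
        (volume : Measure (Euc n)).compProd (Λ.sectR g) := by
    filter_upwards [ae_lt_top (measurable_sliceEnergy (u - n) μ ν) hslice_top] with g hg
    rw [← differenceKernel_apply]
    refine hΛ g ?_
    rw [differenceKernel_fst_apply]
    exact absolutelyContinuous_of_sliceEnergy_lt_top (by linarith) μ ν hg
  refine ⟨fun g z => Λ (g, z), ?_, ?_, ?_, ?_⟩
  · filter_upwards [hψ.ae_prod_weaklyConverges θ μ ν hμ.isCompact_support Λ hΛf hgood,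
      ae_prod_slice_mem θ μ ν Λ hgood] with p h1 h2
    have := hΛf p
    exact ⟨inferInstance, h1, support_subset_of_ae_mem h2⟩
  · filter_upwards [hgood] with g hg
    refine ⟨((Λ.measurable_coe MeasurableSet.univ).comp measurable_prodMk_left).aemeasurable, ?_⟩
    have h1 := congrArg (fun m => m univ) hg
    beta_reduce at h1
    rw [Measure.map_apply (by fun_prop) MeasurableSet.univ, preimage_univ,
      Measure.compProd_apply MeasurableSet.univ] at h1
    rw [← Measure.prod_prod, univ_prod_univ, h1]
    rfl
  · exact (measurable_energy_kernel u Λ).aemeasurable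
  · calc ∫⁻ g, (∫⁻ z, energy u (Λ (g, z))) ∂θ
        ≤ ∫⁻ g, ENNReal.ofReal cu * sliceEnergy (u - n) μ ν g ∂θ := by
          refine lintegral_mono_ae ?_
          filter_upwards [hgood] with g hg
          exact lintegral_energy_slice_le hcu μ ν g (Λ.sectR g) (fun z => hΛf (g, z)) hg
      _ = ENNReal.ofReal cu * ∫⁻ g, sliceEnergy (u - n) μ ν g ∂θ :=
          lintegral_const_mul _ (measurable_sliceEnergy _ μ ν)
      _ ≤ ENNReal.ofReal cu * (ENNReal.ofReal (2 ^ (2 * n) * (β / (β + u - n))) * (Es * Et)) := by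
          gcongr
      _ = _ := by
          rw [hEs', hEt', show cu * 2 ^ (2 * n) * cs⁻¹ * ct⁻¹ * (β / (β + u - n)) =
            cu * ((2 ^ (2 * n) * (β / (β + u - n))) * (cs⁻¹ * ct⁻¹)) by ring,
            ENNReal.ofReal_mul hcu0.le, ENNReal.ofReal_mul (p := 2 ^ (2 * n) * (β / (β + u - n)))
            (by positivity), ENNReal.ofReal_mul (inv_nonneg.2 hcs0.le)]
          ring
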